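/- **Setting.** An assignment game is a finite bipartite graph $G=(U,V,E)$, $E\neq\emptyset$, with positive edge weights $w:E\to\mathbb R_{>0}$ (in particular, rational weights are allowed). The worth $c(S)$ of $S\subseteq U\cup V$ is the maximum weight of a matching in the subgraph induced on $S$. A core imputation is $p:U\cup V\to\mathbb R_{\ge 0}$ with $\sum_q p(q)=c(U\cup V)$ and $\sum_{q\in S}p(q)\ge c(S)$ for all $S$. A vertex is *essential* if every maximum weight matching (MWM) matches it. An edge is *essential* if it is in every MWM, *viable* if it is in some but not all MWMs, *subpar* if it is in none. An edge $(i,j)$ is *tight* for $p$ if $p(i)+p(j)=w_{ij}$. A *leximin core imputation* is a core imputation whose increasingly sorted list of profits of essential vertices is lexicographically largest among all core imputations. Let $T_0$ be the set of essential and viable edges. A connected component of $(U\cup V,T_0)$ is a *unique imputation component* if the profits of its vertices are the same in all core imputations; otherwise it is *fundamental*. For a set $D$ of vertices, $\mathrm{left}(D)$ and $\mathrm{right}(D)$ are the essential vertices of $D$ in $U$ and in $V$, and $\min(D)$ is the smallest current profit of an essential vertex in $D$. $D$ *has min on both sides* (is fully repaired) if both $\mathrm{left}(D)$ and $\mathrm{right}(D)$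 contain a vertex of profit $\min(D)$; if only one side does, $D$ *has min on* that side. **Mechanism.** Initialize: the current imputation is an arbitrary core imputation; $T=T_0$; Frozen consists of the unique imputation components, Bin of the fundamental components, Active and Fully-Repaired are empty; $\Omega$ is the minimum profit of an essential vertex. Components below are those of $H=(U\cup V,T)$. Each component $D$ in Active is a rooted tree of fundamental components joined by added edges. While Bin $\cup$ Active $\ne\emptyset$, raise $\Omega$ at unit rate and simultaneously rotate each component $D$ in Active: if $D$ has min on the left, increase $\mathrm{left}(D)$ and decrease $\mathrm{right}(D)$ at unit rate; if it has min on the right, do the opposite. Before $\Omega$ is raised any further, execute all events that are due, simultaneous ones in any order: * (a) If a component $C$ in Bin has $\min(C)=\Omega$, move it to Active as the root of a new tree. * (b) If a component $D$ in Active, with root $C_0$, has min on both sides, let $S$ be the set of fundamental components $C_i$ in $D$ with $\min(C_i)=\min(C_0)$ such that this minimum is attained in $C_i$ on a side opposite to one on which $C_0$ attained its minimum when it moved to Active. Move $C_0$, all of $S$, and all components on the tree paths from $C_0$ to $S$ to Fully-Repaired. * (c) Suppose there is a *legitimate* edge: a tight subpar edge $(i,j)$ with $i$ in a component $C$ in Active,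 $j$ in another component $C'$ of $H$, where $C$ has min on one side and $i$ lies on the other side of $C$. Let $P$ be the tree path in $C$ from its root to the fundamental component containing $i$. * If $C'$ is in Bin, add the edge to $T$ and move $C'$ to Active, as a child of the fundamental component containing $i$. * If $C'$ is in Active and $C,C'$ have min on opposite sides, add the edge to $T$ and move $P$ and the analogous path in $C'$ (from its root to the fundamental component containing $j$) to Fully-Repaired. (If $C'$ is in Active and $C,C'$ do not have min on opposite sides, no action is due.) * If $C'$ is in Frozen, respectively Fully-Repaired, add the edge to $T$ and move $P$ (together with $C'$) to Frozen, respectively Fully-Repaired. In (b) and in the last two cases of (c), the remaining fundamental components of the Active components involved are moved back to Bin, and every added edge incident to them is removed from $T$. When Bin $\cup$ Active $=\emptyset$, output the current imputation and halt. **Theorem.** There is exactly one leximin core imputation $y$. Let $a_1<\dots<a_k$ be the distinct profits that $y$ assigns to essential vertices, and $W_l=\{q\in U\cup V: y(q)=a_l\}$. Then, for every starting core imputation and every order of executing simultaneous events: 1. the current imputation is always in the core, and for all $1\le l\le k$ and $\varepsilon>0$, whenever $\Omega=a_l+\varepsilon$ during the run, the current imputation agrees with $y$ on $W_1\cup\dots\cup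 W_l$; 2. the mechanism executes only finitely many steps (events, and raisings of $\Omega$ to the next event), it is never stuck before halting, and it halts by time $\Omega=a_k+\varepsilon$ for every $\varepsilon>0$; 3. its output is $y$. -/

import Mathlib

/-- An assignment game: a finite bipartite graph with sides `U`, `V`, edge set `edges`, and a
positive weight on every edge. -/
structure AssignmentGame (U V : Type*) where
  edges : Finset (U × V)
  weight : U × V → ℝ
  weight_pos : ∀ e ∈ edges, 0 < weight e

namespace AssignmentGame

noncomputable section

/-- The two sides of the bipartition; `left` is `U`, `right` is `V`. -/
inductive Side
  | left
  | right

/-- The opposite side. -/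
def Side.opp : Side → Side
  | .left => .right
  | .right => .left

/-- The side on which a vertex (agent) lies. -/
def sideOf {U V : Type*} : U ⊕ V → Side
  | .inl _ => .left
  | .inr _ => .right

section Game

variable {U V : Type*} (G : AssignmentGame U V)

/-! ### Matchings, worth, core -/

/-- `M` is a matching of the bipartite graph. -/
def IsMatching (M : Finset (U × V)) : Prop :=
  M ⊆ G.edges ∧ ∀ e ∈ M, ∀ f ∈ M, (e.1 = f.1 ∨ e.2 = f.2) → e = f

/-- `M` uses only vertices of the sub-coalition `S`. -/
def Within (M : Finset (U × V)) (S : Finset (U ⊕ V)) : Prop :=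
  ∀ e ∈ M, Sum.inl e.1 ∈ S ∧ Sum.inr e.2 ∈ S

/-- The total weight of a set of edges. -/
def totalWeight (M : Finset (U × V)) : ℝ := ∑ e ∈ M, G.weight e

open Classical in
/-- The matchings of the graph restricted to the sub-coalition `S`. -/
def matchingsIn (S : Finset (U ⊕ V)) : Finset (Finset (U × V)) :=
  G.edges.powerset.filter fun M => G.IsMatching M ∧ Within M S

theorem matchingsIn_nonempty (S : Finset (U ⊕ V)) : (G.matchingsIn S).Nonempty :=
  ⟨∅, by
    classical
    exact Finset.mem_filter.2 ⟨Finset.empty_mem_powerset _,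
      ⟨Finset.empty_subset _, fun e he => absurd he (Finset.notMem_empty e)⟩,
      fun e he => absurd he (Finset.notMem_empty e)⟩⟩

/-- The worth of the sub-coalition `S`: the weight of a maximum weight matching in the graph
restricted to `S`. -/
def worth (S : Finset (U ⊕ V)) : ℝ :=
  (G.matchingsIn S).sup' (G.matchingsIn_nonempty S) G.totalWeight

/-- A maximum weight matching of the whole graph. -/
def IsMaxMatching (M : Finset (U × V)) : Prop :=
  G.IsMatching M ∧ ∀ N, G.IsMatching N → G.totalWeight N ≤ G.totalWeight M

/-- An imputation: nonnegative profits which add up to the worth of the grand coalition. -/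
def IsImputation [Fintype U] [Fintype V] (p : U ⊕ V → ℝ) : Prop :=
  (∀ q, 0 ≤ p q) ∧ ∑ q, p q = G.worth Finset.univ

/-- An imputation in the core. -/
def IsCore [Fintype U] [Fintype V] (p : U ⊕ V → ℝ) : Prop :=
  G.IsImputation p ∧ ∀ S : Finset (U ⊕ V), G.worth S ≤ ∑ q ∈ S, p q

/-! ### Essential, viable and subpar vertices and edges -/

/-- The vertex `q` is matched by `M`. -/
def Matched (M : Finset (U × V)) (q : U ⊕ V) : Prop :=
  ∃ e ∈ M, q = Sum.inl e.1 ∨ q = Sum.inr e.2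

/-- An essential vertex is matched in every maximum weight matching. -/
def EssentialVertex (q : U ⊕ V) : Prop := ∀ M, G.IsMaxMatching M → Matched M q

/-- An essential edge belongs to every maximum weight matching. -/
def EssentialEdge (e : U × V) : Prop := e ∈ G.edges ∧ ∀ M, G.IsMaxMatching M → e ∈ M

/-- A viable edge belongs to some but not to all maximum weight matchings. -/
def ViableEdge (e : U × V) : Prop :=
  e ∈ G.edges ∧ (∃ M, G.IsMaxMatching M ∧ e ∈ M) ∧ ∃ M, G.IsMaxMatching M ∧ e ∉ M

/-- A subpar edge belongs to no maximum weight matching. -/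
def SubparEdge (e : U × V) : Prop := e ∈ G.edges ∧ ∀ M, G.IsMaxMatching M → e ∉ M

/-! ### Leximin core imputations -/

open Classical in
/-- The finite set of essential vertices. -/
def essentialVertices [Fintype U] [Fintype V] : Finset (U ⊕ V) :=
  Finset.univ.filter G.EssentialVertex

/-- The profits of the essential vertices, with multiplicity, sorted increasingly. -/
def sortedProfits [Fintype U] [Fintype V] (p : U ⊕ V → ℝ) : List ℝ :=
  (G.essentialVertices.val.map p).sort (· ≤ ·)

/-- A leximin core imputation: its sorted list of profits of essential vertices is
lexicographically largest among all core imputations. -/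
def IsLeximin [Fintype U] [Fintype V] (p : U ⊕ V → ℝ) : Prop :=
  G.IsCore p ∧ ∀ p', G.IsCore p' →
    G.sortedProfits p' = G.sortedProfits p ∨
      List.Lex (· < ·) (G.sortedProfits p') (G.sortedProfits p)

/-- The set of distinct profit shares which `p` assigns to essential vertices. -/
def shareSet [Fintype U] [Fintype V] (p : U ⊕ V → ℝ) : Finset ℝ :=
  G.essentialVertices.image p

/-- The distinct profit shares `share 0 < share 1 < ⋯` of essential vertices under `p`. -/
def share [Fintype U] [Fintype V] (p : U ⊕ V → ℝ) : Fin (G.shareSet p).card ↪o ℝ :=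
  (G.shareSet p).orderEmbOfFin rfl

/-- The current imputation `p` agrees with `y` on all vertices whose share under `y` is one of the
first `l` distinct shares (up to and including index `l`). -/
def AgreesUpTo [Fintype U] [Fintype V] (y : U ⊕ V → ℝ) (l : Fin (G.shareSet y).card)
    (p : U ⊕ V → ℝ) : Prop :=
  ∀ j ≤ l, ∀ q, y q = G.share y j → p q = y q

/-! ### Tight subgraphs and their components -/

/-- The subgraph on all vertices with edge set `T`. -/
def subgraphOf (T : Set (U × V)) : SimpleGraph (U ⊕ V) where
  Adj a b := ∃ e ∈ T, (a = Sum.inl e.1 ∧ b = Sum.inr e.2) ∨ (a = Sum.inr e.2 ∧ b = Sum.inl e.1)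
  symm := ⟨by
    rintro a b ⟨e, he, h⟩
    exact ⟨e, he, h.symm.imp (fun h => ⟨h.2, h.1⟩) (fun h => ⟨h.2, h.1⟩)⟩⟩
  loopless := ⟨by
    rintro a ⟨e, -, ⟨h, h'⟩ | ⟨h, h'⟩⟩ <;> simp [h] at h'⟩

/-- The starting set of tight edges: all essential and viable edges. -/
def startEdges : Set (U × V) := {e | G.EssentialEdge e ∨ G.ViableEdge e}

/-- The connected components of the starting tight subgraph. -/
abbrev Comp : Type _ := (subgraphOf G.startEdges).ConnectedComponent

/-- The component of the starting tight subgraph that contains `q`. -/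
def compOf (q : U ⊕ V) : G.Comp := (subgraphOf G.startEdges).connectedComponentMk q

/-- `C` is a unique imputation component: the profits of its vertices are the same in all core
imputations. Components which are not of this kind are called fundamental. -/
def UniqueImputation [Fintype U] [Fintype V] (C : G.Comp) : Prop :=
  ∀ p p', G.IsCore p → G.IsCore p' → ∀ q ∈ C.supp, p q = p' q

/-- The components of the starting tight subgraph that make up the vertex set `D`. -/
def parts (D : Set (U ⊕ V)) : Set G.Comp := {C | C.supp ⊆ D}

/-- `left(D)` and `right(D)`: the essential vertices of `D` on the side `s`. -/
def part (s : Side) (D : Set (U ⊕ V)) : Set (U ⊕ V) :=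
  {q | q ∈ D ∧ G.EssentialVertex q ∧ sideOf q = s}

/-- `min(D)`: the smallest profit share of an essential vertex in `D`. -/
def minShare (p : U ⊕ V → ℝ) (D : Set (U ⊕ V)) : ℝ :=
  sInf (p '' {q | q ∈ D ∧ G.EssentialVertex q})

/-- Some essential vertex of `D` on side `s` has profit `min(D)`. -/
def AttainsMin (p : U ⊕ V → ℝ) (s : Side) (D : Set (U ⊕ V)) : Prop :=
  ∃ q ∈ G.part s D, p q = G.minShare p D

/-- `D` has min on both sides, i.e. it is fully repaired. -/
def MinOnBoth (p : U ⊕ V → ℝ) (D : Set (U ⊕ V)) : Prop :=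
  G.AttainsMin p .left D ∧ G.AttainsMin p .right D

/-- `D` has min in `left(D)` (for `s = left`) or in `right(D)` (for `s = right`), and not on both
sides. -/
def HasMinIn (p : U ⊕ V → ℝ) (s : Side) (D : Set (U ⊕ V)) : Prop :=
  ¬ G.MinOnBoth p D ∧ G.AttainsMin p s D

end Game

/-! ### States of the mechanism -/

/-- Where a component of the starting tight subgraph currently is. -/
inductive Status
  | frozen
  | bin
  | active
  | repaired

/-- A state of the mechanism. -/
structure State {U V : Type*} (G : AssignmentGame U V) where
  /-- the current imputation -/
  profit : U ⊕ V → ℝ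
  /-- the current value of the time variable `Ω` -/
  Ω : ℝ
  /-- the edge set of the tight subgraph `H` -/
  T : Set (U × V)
  /-- the set among Frozen, Bin, Active, Fully-Repaired to which each component belongs -/
  status : G.Comp → Status
  /-- the parent of a component in the tree of its valid component; `none` for a root -/
  parent : G.Comp → Option G.Comp
  /-- the sides on which a root component attained its min when it was moved to Active -/
  entrySides : G.Comp → Set Side

namespace State

variable {U V : Type*} {G : AssignmentGame U V}

/-- The vertex set of the connected component of the tight subgraph `H` that contains `q`. -/
def component (σ : State G) (q : U ⊕ V) : Set (U ⊕ V) :=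
  ((subgraphOf σ.T).connectedComponentMk q).supp

/-- The mechanism has left its main loop: nothing is in Bin or Active. -/
def Halted (σ : State G) : Prop := ∀ C, σ.status C ≠ .bin ∧ σ.status C ≠ .active

/-- `C'` is a descendent of `C`: the reflexive transitive closure of the child relation. -/
def Descendent (σ : State G) (C C' : G.Comp) : Prop :=
  Relation.ReflTransGen (fun A B => σ.parent B = some A) C C'

/-- `C` is intermediate between `A` and its descendent `B`. -/
def Intermediate (σ : State G) (A B C : G.Comp) : Prop :=
  σ.Descendent A C ∧ σ.Descendent C B

/-- `C₀` is the root fundamental component of the valid component `D`. -/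
def IsRoot (σ : State G) (D : Set (U ⊕ V)) (C₀ : G.Comp) : Prop :=
  C₀ ∈ G.parts D ∧ ∀ C ∈ G.parts D, σ.Descendent C₀ C

/-- The components on the tree path from the root of the valid component `D` to `C₁`. -/
def rootPath (σ : State G) (D : Set (U ⊕ V)) (C₁ : G.Comp) : Set G.Comp :=
  {C | ∃ C₀, σ.IsRoot D C₀ ∧ σ.Intermediate C₀ C₁ C}

/-- Those components of `D` whose min equals that of the root `C₀` and is attained on a side
opposite to one on which `C₀` attained its min when it was moved to Active. -/
def counterMin (σ : State G) (D : Set (U ⊕ V)) (C₀ : G.Comp) : Set G.Comp :=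
  {C | C ∈ G.parts D ∧ σ.Descendent C₀ C ∧
    G.minShare σ.profit C.supp = G.minShare σ.profit C₀.supp ∧
    ∃ s ∈ σ.entrySides C₀, G.AttainsMin σ.profit s.opp C.supp}

/-- The minimum fully repaired sub-component of a valid component `D` with min on both sides: the
root `C₀`, the components in `counterMin`, and all components intermediate between them. -/
def minSub1 (σ : State G) (D : Set (U ⊕ V)) : Set G.Comp :=
  {C | ∃ C₀, σ.IsRoot D C₀ ∧ (C = C₀ ∨ ∃ B ∈ σ.counterMin D C₀, σ.Intermediate C₀ B C)}

/-- The minimum fully repaired sub-component of the union of two valid components, containing `x`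
and `y` respectively, joined by an edge between `x` and `y`. -/
def minSub2 (σ : State G) (x y : U ⊕ V) : Set G.Comp :=
  σ.rootPath (σ.component x) (G.compOf x) ∪ σ.rootPath (σ.component y) (G.compOf y)

/-- The minimum fully repaired sub-component of the union of the valid component containing `x`
and the frozen or fully repaired component containing `y`, joined by an edge between `x`
and `y`. -/
def minSub3 (σ : State G) (x y : U ⊕ V) : Set G.Comp :=
  σ.rootPath (σ.component x) (G.compOf x) ∪ G.parts (σ.component y)

open Classical in
/-- With `R` a component of the tight subgraph with edge set `T'`: move the sub-component `M` of
`R` to the set `st`, decompose the rest of `R` into fundamental components, and move these back to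
Bin. The decomposition removes from the tight subgraph every added edge that is incident to the
rest of `R`. -/
def settle (σ : State G) (T' : Set (U × V)) (R M : Set G.Comp) (st : Status) : State G :=
  { σ with
    T := {e | e ∈ T' ∧ (e ∈ G.startEdges ∨
      (G.compOf (Sum.inl e.1) ∉ R \ M ∧ G.compOf (Sum.inr e.2) ∉ R \ M))}
    status := fun C => if C ∈ R then (if C ∈ M then st else .bin) else σ.status C
    parent := fun C => if C ∈ R \ M then none else σ.parent C }

/-- `e` is a legitimate edge: a tight subpar edge with one endpoint `x` in a component `C` in
Active and the other endpoint `y` in another component of the tight subgraph, such that `C` has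
min on one side and `x` is on the other side of `C`. -/
def Legitimate (σ : State G) (e : U × V) (x y : U ⊕ V) : Prop :=
  G.SubparEdge e ∧
  ((x = Sum.inl e.1 ∧ y = Sum.inr e.2) ∨ (x = Sum.inr e.2 ∧ y = Sum.inl e.1)) ∧
  σ.profit (Sum.inl e.1) + σ.profit (Sum.inr e.2) = G.weight e ∧
  σ.status (G.compOf x) = .active ∧
  y ∉ σ.component x ∧
  ∃ s, G.HasMinIn σ.profit s (σ.component x) ∧ x ∈ G.part s.opp (σ.component x)

open Classical in
/-- One execution of an event of the main loop; simultaneous events may be executed in any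
order. -/
inductive Event (σ : State G) : State G → Prop
  /-- A component `C` in Bin with `min(C) = Ω` moves to Active and becomes a root. -/
  | activate (C : G.Comp) (hC : σ.status C = .bin) (hmin : G.minShare σ.profit C.supp = σ.Ω) :
      Event σ { σ with
        status := Function.update σ.status C .active
        parent := Function.update σ.parent C none
        entrySides := Function.update σ.entrySides C {s | G.AttainsMin σ.profit s C.supp} }
  /-- A component in Active is fully repaired. -/
  | repair (x : U ⊕ V) (hx : σ.status (G.compOf x) = .active)
      (hboth : G.MinOnBoth σ.profit (σ.component x)) :
      Event σ (σ.settle σ.T (G.parts (σ.component x)) (σ.minSub1 (σ.component x)) .repaired)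
  /-- A legitimate edge leads to a component in Bin, which becomes a child. -/
  | grow (e : U × V) (x y : U ⊕ V) (he : σ.Legitimate e x y)
      (hy : σ.status (G.compOf y) = .bin) :
      Event σ { σ with
        T := insert e σ.T
        status := Function.update σ.status (G.compOf y) .active
        parent := Function.update σ.parent (G.compOf y) (some (G.compOf x)) }
  /-- A legitimate edge joins two components in Active which have min on opposite sides. -/
  | meet (e : U × V) (x y : U ⊕ V) (he : σ.Legitimate e x y)
      (hy : σ.status (G.compOf y) = .active)
      (hopp : ∃ s : Side, G.HasMinIn σ.profit s (σ.component x) ∧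
        G.HasMinIn σ.profit s.opp (σ.component y)) :
      Event σ (σ.settle (insert e σ.T) (G.parts (σ.component x) ∪ G.parts (σ.component y))
        (σ.minSub2 x y) .repaired)
  /-- A legitimate edge leads to a component in Frozen. -/
  | freeze (e : U × V) (x y : U ⊕ V) (he : σ.Legitimate e x y)
      (hy : σ.status (G.compOf y) = .frozen) :
      Event σ (σ.settle (insert e σ.T) (G.parts (σ.component x) ∪ G.parts (σ.component y))
        (σ.minSub3 x y) .frozen)
  /-- A legitimate edge leads to a component in Fully-Repaired. -/
  | attach (e : U × V) (x y : U ⊕ V) (he : σ.Legitimate e x y)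
      (hy : σ.status (G.compOf y) = .repaired) :
      Event σ (σ.settle (insert e σ.T) (G.parts (σ.component x) ∪ G.parts (σ.component y))
        (σ.minSub3 x y) .repaired)

open Classical in
/-- The rate of change of the profit of `q`. A component in Active with min on the left is rotated
clockwise (`left` increases and `right` decreases at unit rate), one with min on the right is
rotated anti-clockwise; all other profits stay fixed. -/
def rate (σ : State G) (q : U ⊕ V) : ℝ :=
  if σ.status (G.compOf q) = .active ∧ G.EssentialVertex q then
    if G.HasMinIn σ.profit (sideOf q) (σ.component q) then 1
    else if G.HasMinIn σ.profit (sideOf q).opp (σ.component q) then -1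
    else 0
  else 0

/-- Raise `Ω` by `t` at unit rate while repairing the components in Active. -/
def advance (σ : State G) (t : ℝ) : State G :=
  { σ with
    profit := fun q => σ.profit q + t * σ.rate q
    Ω := σ.Ω + t }

/-- Some event can be executed. -/
def EventDue (σ : State G) : Prop := ∃ σ', Event σ σ'

/-- Starting from the non-halted state `σ`, raising `Ω` continuously, the first event becomes due
after a positive amount of time `δ`. -/
def NextEventAfter (σ : State G) (δ : ℝ) : Prop :=
  ¬ σ.Halted ∧ 0 < δ ∧ (σ.advance δ).EventDue ∧ ∀ t, 0 ≤ t → t < δ → ¬ (σ.advance t).EventDue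

/-- One step of the mechanism: execute an event, or, if no event is due, raise `Ω` until the next
time at which an event is due. -/
inductive Step (σ : State G) : State G → Prop
  | event (σ' : State G) (h : Event σ σ') : Step σ σ'
  | raise (δ : ℝ) (h : σ.NextEventAfter δ) : Step σ (σ.advance δ)

/-- `τ` is reached from `σ` by steps of the mechanism. -/
def Reaches (σ τ : State G) : Prop := Relation.ReflTransGen Step σ τ

/-- `τ` occurs in a run from `σ`: it is reached by steps, or it is passed through while `Ω` is
being raised continuously in such a step. -/
def Occurs (σ τ : State G) : Prop :=
  ∃ ρ, σ.Reaches ρ ∧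
    (τ = ρ ∨ ∃ δ, ρ.NextEventAfter δ ∧ ∃ t, 0 ≤ t ∧ t ≤ δ ∧ τ = ρ.advance t)

end State

open Classical in
/-- The state of the mechanism after its initialization with the core imputation `p`: unique
imputation components are in Frozen, fundamental components are in Bin, and `Ω` is the minimum
profit share of an essential vertex. -/
def startState {U V : Type*} [Fintype U] [Fintype V] (G : AssignmentGame U V) (p : U ⊕ V → ℝ) :
    State G where
  profit := p
  Ω := G.minShare p Set.univ
  T := G.startEdges
  status := fun C => if G.UniqueImputation C then .frozen else .bin
  parent := fun _ => none
  entrySides := fun _ => ∅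

end

end AssignmentGame

/-!
By linear programming duality the core consists of the optimal solutions of the dual of the maximum
weight matching problem, so all core imputations make the essential and viable edges tight and
vanish off the essential vertices. Hence the change from the current imputation `p` to another core
imputation `z` is, up to a sign that depends on the side, constant on every component of the
starting tight subgraph, and along an added tight edge it can only grow in one direction.

The invariant behind correctness is rigidity: a core imputation which is at least `θ` wherever it
differs from `p` agrees with `p` on every settled component, where `θ` is a lower bound for the
profits on this component. A tree in Active is held from both ends when it settles. At the root a
vertex of profit `Ω` cannot lose, and this propagates down the tree; at the other end the same
holds for the opposite side, by a second minimum or by rigidity of what the tree has been joined to.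
Once nothing is left in Bin or Active, a core imputation `z ≠ p` must somewhere fall below all the
profits of `p` at the vertices where they differ, so it is lexicographically smaller. This proves
at once that the output is the only leximin core imputation and that it is the same for all runs.

Settled profits are final, and the other ones stay at or above `Ω`; this gives progress. Between
events everything moves affinely, so that the next event is the first time at which one of finitely
many decreasing affine functions vanishes. An event settles an unsettled component, or else takes
one out of Bin without unsettling any: this bounds the number of steps.
-/

namespace AssignmentGame

open Filter Topology

/-! ### Sides and edges -/

@[simp] theorem Side.opp_opp (s : Side) : s.opp.opp = s := by cases s <;> rfl

theorem Side.ne_opp (s : Side) : s ≠ s.opp := by cases s <;> simp [Side.opp]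

theorem Side.eq_or_eq_opp (s t : Side) : t = s ∨ t = s.opp := by
  cases s <;> cases t <;> simp [Side.opp]

section Edges

variable {U V : Type*}

/-- The endpoint of the edge `e` on the side `s`. -/
def endpoint (s : Side) (e : U × V) : U ⊕ V :=
  match s with
  | .left => .inl e.1
  | .right => .inr e.2

/-- The edge `e` has endpoints `x` and `y`, in either order. -/
def Joins (e : U × V) (x y : U ⊕ V) : Prop :=
  (x = .inl e.1 ∧ y = .inr e.2) ∨ (x = .inr e.2 ∧ y = .inl e.1)

@[simp] theorem sideOf_endpoint (s : Side) (e : U × V) : sideOf (endpoint s e) = s := by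
  cases s <;> rfl

theorem endpoint_ext {e e' : U × V} (s : Side) (h : endpoint s e = endpoint s e')
    (h' : endpoint s.opp e = endpoint s.opp e') : e = e' := by
  cases s <;> simp_all [endpoint, Side.opp, Prod.ext_iff]

theorem joins_self (e : U × V) : Joins e (.inl e.1) (.inr e.2) := .inl ⟨rfl, rfl⟩

theorem joins_endpoint (s : Side) (e : U × V) : Joins e (endpoint s e) (endpoint s.opp e) := by
  cases s <;> simp [Joins, endpoint, Side.opp]

namespace Joins

variable {e : U × V} {x y : U ⊕ V}

theorem symm (h : Joins e x y) : Joins e y x := (Or.symm h).imp And.symm And.symm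

theorem eq_or_eq {x' y' : U ⊕ V} (h : Joins e x y) (h' : Joins e x' y') : x' = x ∨ x' = y := by
  obtain ⟨rfl, rfl⟩ | ⟨rfl, rfl⟩ := h
  exacts [h'.imp And.left And.left, (h'.imp And.left And.left).symm]

theorem eq_endpoint (h : Joins e x y) : x = endpoint (sideOf x) e := by
  obtain ⟨rfl, -⟩ | ⟨rfl, -⟩ := h <;> rfl

theorem sideOf_eq (h : Joins e x y) : sideOf y = (sideOf x).opp := by
  obtain ⟨rfl, rfl⟩ | ⟨rfl, rfl⟩ := h <;> rfl

theorem apply_eq {α : Type*} {f : U ⊕ V → α} (h : Joins e x y) (hf : f (.inl e.1) = f (.inr e.2)) :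
    f x = f y := by
  obtain ⟨rfl, rfl⟩ | ⟨rfl, rfl⟩ := h
  exacts [hf, hf.symm]

theorem add_eq {α : Type*} [AddCommMagma α] (h : Joins e x y) (p : U ⊕ V → α) :
    p (.inl e.1) + p (.inr e.2) = p x + p y := by
  obtain ⟨rfl, rfl⟩ | ⟨rfl, rfl⟩ := h
  exacts [rfl, add_comm _ _]

end Joins

end Edges

/-! ### Matchings -/

section Matchings

variable {U V : Type*} {G : AssignmentGame U V} {M : Finset (U × V)} {S : Finset (U ⊕ V)}
  {e : U × V}

theorem mem_matchingsIn : M ∈ G.matchingsIn S ↔ G.IsMatching M ∧ Within M S := by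
  classical
  simp only [matchingsIn, Finset.mem_filter, Finset.mem_powerset]
  exact ⟨fun h => h.2, fun h => ⟨h.1.1, h⟩⟩

theorem within_univ [Fintype U] [Fintype V] (M : Finset (U × V)) : Within M Finset.univ :=
  fun _ _ => ⟨Finset.mem_univ _, Finset.mem_univ _⟩

theorem isMatching_empty (G : AssignmentGame U V) : G.IsMatching ∅ :=
  ⟨Finset.empty_subset _, fun e he => absurd he (Finset.notMem_empty e)⟩

theorem isMatching_singleton (he : e ∈ G.edges) : G.IsMatching {e} := by
  refine ⟨Finset.singleton_subset_iff.2 he, fun a ha b hb _ => ?_⟩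
  rw [Finset.mem_singleton.1 ha, Finset.mem_singleton.1 hb]

theorem IsMatching.totalWeight_le_worth (hM : G.IsMatching M) (hS : Within M S) :
    G.totalWeight M ≤ G.worth S :=
  Finset.le_sup' _ (mem_matchingsIn.2 ⟨hM, hS⟩)

theorem exists_totalWeight_eq_worth (G : AssignmentGame U V) (S : Finset (U ⊕ V)) :
    ∃ M, G.IsMatching M ∧ Within M S ∧ G.totalWeight M = G.worth S := by
  obtain ⟨M, hM, h⟩ := Finset.exists_mem_eq_sup' (G.matchingsIn_nonempty S) G.totalWeight
  rw [mem_matchingsIn] at hM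
  exact ⟨M, hM.1, hM.2, h.symm⟩

theorem exists_isMaxMatching (G : AssignmentGame U V) : ∃ M, G.IsMaxMatching M := by
  classical
  obtain ⟨M, hM, hmax⟩ := (G.edges.powerset.filter G.IsMatching).exists_max_image G.totalWeight
    ⟨∅, Finset.mem_filter.2 ⟨Finset.empty_mem_powerset _, G.isMatching_empty⟩⟩
  exact ⟨M, (Finset.mem_filter.1 hM).2, fun N hN =>
    hmax N (Finset.mem_filter.2 ⟨Finset.mem_powerset.2 hN.1, hN⟩)⟩

theorem IsMaxMatching.totalWeight_eq [Fintype U] [Fintype V] (hM : G.IsMaxMatching M) :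
    G.totalWeight M = G.worth Finset.univ := by
  obtain ⟨N, hN, -, h⟩ := G.exists_totalWeight_eq_worth Finset.univ
  exact le_antisymm (hM.1.totalWeight_le_worth (within_univ M)) (h ▸ hM.2 N hN)

open Classical in
/-- The finite set of vertices matched by `M`. -/
noncomputable def matchedFinset (M : Finset (U × V)) : Finset (U ⊕ V) :=
  (M.image Prod.fst).disjSum (M.image Prod.snd)

theorem mem_matchedFinset {q : U ⊕ V} : q ∈ matchedFinset M ↔ Matched M q := by
  classical
  cases q <;> simp [matchedFinset, Matched, eq_comm]

theorem IsMatching.sum_add {α : Type*} [AddCommMonoid α] (hM : G.IsMatching M) (p : U ⊕ V → α) :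
    ∑ e ∈ M, (p (.inl e.1) + p (.inr e.2)) = ∑ q ∈ matchedFinset M, p q := by
  classical
  rw [matchedFinset, Finset.sum_disjSum, Finset.sum_add_distrib, Finset.sum_image, Finset.sum_image]
  · exact fun a ha b hb h => hM.2 a ha b hb (.inr h)
  · exact fun a ha b hb h => hM.2 a ha b hb (.inl h)

theorem mem_edges_of_mem_startEdges (he : e ∈ G.startEdges) : e ∈ G.edges :=
  he.elim (fun h => h.1) fun h => h.1

theorem exists_isMaxMatching_mem (he : e ∈ G.startEdges) : ∃ M, G.IsMaxMatching M ∧ e ∈ M := by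
  obtain h | h := he
  · obtain ⟨M, hM⟩ := G.exists_isMaxMatching
    exact ⟨M, hM, h.2 M hM⟩
  · exact h.2.1

theorem IsMaxMatching.mem_startEdges (hM : G.IsMaxMatching M) (he : e ∈ M) : e ∈ G.startEdges := by
  by_cases h : ∀ N, G.IsMaxMatching N → e ∈ N
  · exact .inl ⟨hM.1.1 he, h⟩
  · push Not at h
    exact .inr ⟨hM.1.1 he, ⟨M, hM, he⟩, h⟩

theorem subparEdge_of_notMem_startEdges (he : e ∈ G.edges) (h : e ∉ G.startEdges) :
    G.SubparEdge e :=
  ⟨he, fun _ hM heM => h (hM.mem_startEdges heM)⟩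

end Matchings

/-! ### Linear programming duality -/

section Duality

variable {U V : Type*} {G : AssignmentGame U V} {p : U ⊕ V → ℝ} {M : Finset (U × V)}
  {S : Finset (U ⊕ V)} {e : U × V}

/-- The feasible solutions of the linear program dual to maximum weight matching. -/
structure IsCover (G : AssignmentGame U V) (p : U ⊕ V → ℝ) : Prop where
  nonneg : ∀ q, 0 ≤ p q
  weight_le : ∀ e ∈ G.edges, G.weight e ≤ p (.inl e.1) + p (.inr e.2)

theorem IsCover.totalWeight_le_sum (hp : G.IsCover p) (hM : G.IsMatching M) (hS : Within M S) :
    G.totalWeight M ≤ ∑ q ∈ S, p q := by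
  calc G.totalWeight M ≤ ∑ e ∈ M, (p (.inl e.1) + p (.inr e.2)) :=
        Finset.sum_le_sum fun e he => hp.weight_le e (hM.1 he)
    _ = ∑ q ∈ matchedFinset M, p q := hM.sum_add p
    _ ≤ ∑ q ∈ S, p q := by
        refine Finset.sum_le_sum_of_subset_of_nonneg (fun q hq => ?_) fun q _ _ => hp.nonneg q
        obtain ⟨e, he, rfl | rfl⟩ := mem_matchedFinset.1 hq
        exacts [(hS e he).1, (hS e he).2]

variable [Fintype U] [Fintype V]

theorem IsCover.isCore_of_sum_le (hp : G.IsCover p) (hM : G.IsMatching M)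
    (h : ∑ q, p q ≤ G.totalWeight M) : G.IsCore p := by
  have hworth (S : Finset (U ⊕ V)) : G.worth S ≤ ∑ q ∈ S, p q := by
    obtain ⟨N, hN, hS, hNS⟩ := G.exists_totalWeight_eq_worth S
    exact hNS ▸ hp.totalWeight_le_sum hN hS
  exact ⟨⟨hp.nonneg, le_antisymm (h.trans (hM.totalWeight_le_worth (within_univ M))) (hworth _)⟩,
    hworth⟩

theorem IsCore.isCover (hp : G.IsCore p) : G.IsCover p where
  nonneg := hp.1.1
  weight_le e he := by
    classical
    have hle : G.worth {.inl e.1, .inr e.2} ≤ p (.inl e.1) + p (.inr e.2) := by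
      simpa only [Finset.sum_pair (Sum.inl_ne_inr (a := e.1) (b := e.2))] using
        hp.2 {.inl e.1, .inr e.2}
    have hwithin : Within {e} ({.inl e.1, .inr e.2} : Finset (U ⊕ V)) := by simp [Within]
    calc G.weight e = G.totalWeight {e} := (Finset.sum_singleton _ _).symm
      _ ≤ _ := ((isMatching_singleton he).totalWeight_le_worth hwithin).trans hle

theorem IsCore.complementary_slackness (hp : G.IsCore p) (hM : G.IsMaxMatching M) :
    (∀ e ∈ M, p (.inl e.1) + p (.inr e.2) = G.weight e) ∧ ∀ q, ¬ Matched M q → p q = 0 := by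
  classical
  have hweight : ∀ e ∈ M, G.weight e ≤ p (.inl e.1) + p (.inr e.2) :=
    fun e he => hp.isCover.weight_le e (hM.1.1 he)
  have htotal : ∑ e ∈ M, G.weight e = ∑ q, p q := hM.totalWeight_eq.trans hp.1.2.symm
  have hcompl_nonneg : 0 ≤ ∑ q ∈ (matchedFinset M)ᶜ, p q :=
    Finset.sum_nonneg fun q _ => hp.isCover.nonneg q
  have hsplit := Finset.sum_add_sum_compl (matchedFinset M) p
  rw [← hM.1.sum_add, ← htotal] at hsplit
  have hsum_le := Finset.sum_le_sum hweight
  refine ⟨fun e he => ?_, fun q hq => ?_⟩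
  · exact ((Finset.sum_eq_sum_iff_of_le hweight).1 (by linarith) e he).symm
  · have hcompl : ∑ q ∈ (matchedFinset M)ᶜ, p q = 0 := by linarith
    refine (Finset.sum_eq_zero_iff_of_nonneg fun q _ => hp.isCover.nonneg q).1 hcompl q ?_
    rwa [Finset.mem_compl, mem_matchedFinset]

theorem IsCore.tight (hp : G.IsCore p) (he : e ∈ G.startEdges) :
    p (.inl e.1) + p (.inr e.2) = G.weight e := by
  obtain ⟨M, hM, h⟩ := exists_isMaxMatching_mem he
  exact (hp.complementary_slackness hM).1 e h

theorem IsCore.eq_zero (hp : G.IsCore p) {q : U ⊕ V} (hq : ¬ G.EssentialVertex q) : p q = 0 := by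
  simp only [EssentialVertex, not_forall] at hq
  obtain ⟨M, hM, h⟩ := hq
  exact (hp.complementary_slackness hM).2 q h

theorem IsCover.isCore_of_tight (hp : G.IsCover p)
    (htight : ∀ e ∈ G.startEdges, p (.inl e.1) + p (.inr e.2) = G.weight e)
    (hzero : ∀ q, ¬ G.EssentialVertex q → p q = 0) : G.IsCore p := by
  classical
  obtain ⟨M, hM⟩ := G.exists_isMaxMatching
  refine hp.isCore_of_sum_le hM.1 (le_of_eq ?_)
  have hcompl : ∑ q ∈ (matchedFinset M)ᶜ, p q = 0 := Finset.sum_eq_zero fun q hq =>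
    hzero q fun h => Finset.mem_compl.1 hq (mem_matchedFinset.2 (h M hM))
  rw [← Finset.sum_add_sum_compl (matchedFinset M) p, hcompl, add_zero, ← hM.1.sum_add p]
  exact Finset.sum_congr rfl fun e he => htight e (hM.mem_startEdges he)

end Duality

/-! ### Nonemptiness of the core -/

theorem eventually_forall_add_mul_nonneg {ι : Type*} [Finite ι] {a b : ι → ℝ}
    (ha : ∀ i, 0 ≤ a i) (hab : ∀ i, a i = 0 → 0 ≤ b i) :
    ∀ᶠ ε : ℝ in 𝓝[>] 0, ∀ i, 0 ≤ a i + ε * b i := by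
  refine eventually_all.2 fun i => ?_
  obtain hi | hi := (ha i).eq_or_lt
  · filter_upwards [self_mem_nhdsWithin] with ε hε
    simpa [← hi] using mul_nonneg (le_of_lt hε) (hab i hi.symm)
  · have hlim : Tendsto (fun ε : ℝ => a i + ε * b i) (𝓝[>] 0) (𝓝 (a i + 0 * b i)) :=
      Tendsto.mono_left (Continuous.tendsto (by fun_prop) _) nhdsWithin_le_nhds
    rw [zero_mul, add_zero] at hlim
    filter_upwards [hlim.eventually_const_lt hi] with ε hε using hε.le

section Nonempty

variable {U V : Type*} {G : AssignmentGame U V} {p : U ⊕ V → ℝ}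

theorem isClosed_setOf_isCover (G : AssignmentGame U V) : IsClosed {p | G.IsCover p} := by
  have hinter : {p | G.IsCover p} = (⋂ q, {p | 0 ≤ p q}) ∩
      ⋂ e ∈ G.edges, {p | G.weight e ≤ p (.inl e.1) + p (.inr e.2)} := by
    ext p
    simp only [Set.mem_ofPred_eq, Set.mem_inter_iff, Set.mem_iInter]
    exact ⟨fun h => ⟨h.nonneg, h.weight_le⟩, fun h => ⟨h.1, h.2⟩⟩
  rw [hinter]
  exact (isClosed_iInter fun q => isClosed_le continuous_const (continuous_apply q)).inter
    (isClosed_biInter fun e _ => isClosed_le continuous_const (by fun_prop))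

theorem isCover_const_sum_weight (G : AssignmentGame U V) :
    G.IsCover fun _ => ∑ e ∈ G.edges, G.weight e where
  nonneg _ := Finset.sum_nonneg fun e he => (G.weight_pos e he).le
  weight_le _ he := (Finset.single_le_sum (fun e he => (G.weight_pos e he).le) he).trans
    (le_add_of_nonneg_left (Finset.sum_nonneg fun e he => (G.weight_pos e he).le))

theorem IsCover.exists_pos_isCover_add_mul [Finite U] [Finite V] (hp : G.IsCover p) {d : U ⊕ V → ℝ}
    (hd : ∀ q, p q = 0 → 0 ≤ d q)
    (hd' : ∀ e ∈ G.edges, p (.inl e.1) + p (.inr e.2) = G.weight e →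
      0 ≤ d (.inl e.1) + d (.inr e.2)) :
    ∃ ε > 0, G.IsCover fun q => p q + ε * d q := by
  have hnonneg := eventually_forall_add_mul_nonneg hp.nonneg hd
  have hweight := eventually_forall_add_mul_nonneg (ι := G.edges)
    (a := fun e => p (.inl e.1.1) + p (.inr e.1.2) - G.weight e)
    (b := fun e => d (.inl e.1.1) + d (.inr e.1.2))
    (fun e => sub_nonneg.2 (hp.weight_le e e.2)) fun e he => hd' e e.2 (sub_eq_zero.1 he)
  obtain ⟨ε, ⟨hε, hεw⟩, hpos⟩ := ((hnonneg.and hweight).and self_mem_nhdsWithin).exists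
  exact ⟨ε, hpos, hε, fun e he => by linarith [hεw ⟨e, he⟩]⟩

/-- The pairs of vertices which an optimal dual solution `p` allows to be matched: `q` may be
paired with its neighbours along tight edges, and with itself (that is, left unmatched) if its
price is zero. -/
def SlackPartner (G : AssignmentGame U V) (p : U ⊕ V → ℝ) (q r : U ⊕ V) : Prop :=
  (q = r ∧ p q = 0) ∨
    ∃ e ∈ G.edges, p (.inl e.1) + p (.inr e.2) = G.weight e ∧ Joins e q r

variable [Fintype U] [Fintype V]

theorem exists_isMinOn_isCover (G : AssignmentGame U V) :
    ∃ p, G.IsCover p ∧ IsMinOn (fun p => ∑ q, p q) {p | G.IsCover p} p := by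
  set p₀ : U ⊕ V → ℝ := fun _ => ∑ e ∈ G.edges, G.weight e
  refine ContinuousOn.exists_isMinOn' (by fun_prop) G.isClosed_setOf_isCover
    G.isCover_const_sum_weight (eventually_inf_principal.2 ?_)
  have hbox : IsCompact (Set.Icc (0 : U ⊕ V → ℝ) fun _ => ∑ q, p₀ q) := isCompact_Icc
  filter_upwards [hbox.compl_mem_cocompact] with p hpbox hp
  by_contra! hlt
  exact hpbox ⟨hp.nonneg, fun q =>
    (Finset.single_le_sum (fun r _ => hp.nonneg r) (Finset.mem_univ q)).trans hlt.le⟩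

theorem IsCover.sum_nonneg_of_isMinOn (hp : G.IsCover p)
    (hmin : IsMinOn (fun p => ∑ q, p q) {p | G.IsCover p} p) {d : U ⊕ V → ℝ}
    (hd : ∀ q, p q = 0 → 0 ≤ d q)
    (hd' : ∀ e ∈ G.edges, p (.inl e.1) + p (.inr e.2) = G.weight e →
      0 ≤ d (.inl e.1) + d (.inr e.2)) :
    0 ≤ ∑ q, d q := by
  obtain ⟨ε, hε, hcover⟩ := hp.exists_pos_isCover_add_mul hd hd'
  have hle : ∑ q, p q ≤ ∑ q, (p q + ε * d q) := hmin hcover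
  rw [Finset.sum_add_distrib, ← Finset.mul_sum] at hle
  exact nonneg_of_mul_nonneg_right (le_add_iff_nonneg_right _ |>.1 hle) hε

open Classical in
-- Raising the prices of the partners of `S` and lowering those of `S` is a feasible direction.
theorem IsCover.card_le_card_biUnion_slackPartner (hp : G.IsCover p)
    (hmin : IsMinOn (fun p => ∑ q, p q) {p | G.IsCover p} p) (S : Finset (U ⊕ V)) :
    S.card ≤ (S.biUnion fun q => Finset.univ.filter (G.SlackPartner p q)).card := by
  set N := S.biUnion fun q => Finset.univ.filter (G.SlackPartner p q)
  let ind (A : Finset (U ⊕ V)) (q : U ⊕ V) : ℝ := if q ∈ A then 1 else 0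
  have hind {q r : U ⊕ V} (h : G.SlackPartner p q r) : ind S q ≤ ind N r := by
    by_cases hq : q ∈ S
    · have hr : r ∈ N := Finset.mem_biUnion.2 ⟨q, hq, by simpa using h⟩
      simp [ind, hq, hr]
    · simp only [ind, hq, if_false]
      split_ifs <;> norm_num
  have hsum : 0 ≤ ∑ q, (ind N q - ind S q) := by
    refine hp.sum_nonneg_of_isMinOn hmin (fun q hq => sub_nonneg.2 (hind (.inl ⟨rfl, hq⟩)))
      fun e he ht => ?_
    have hl := hind (.inr ⟨e, he, ht, joins_self e⟩)
    have hr := hind (.inr ⟨e, he, ht, (joins_self e).symm⟩)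
    linarith
  have hcard : ∑ q, (ind N q - ind S q) = (N.card : ℝ) - S.card := by simp [ind]
  exact_mod_cast sub_nonneg.1 (hcard ▸ hsum)

open Classical in
/-- The edges along which `f` moves the vertices of the side `s`: a bijection of the vertices which
respects slackness splits into the two matchings `alongEdges f left` and `alongEdges f right`. -/
noncomputable def alongEdges (f : U ⊕ V → U ⊕ V) (s : Side) : Finset (U × V) :=
  Finset.univ.filter fun e => f (endpoint s e) = endpoint s.opp e

variable {f : U ⊕ V → U ⊕ V} {s : Side} {e : U × V}

theorem mem_alongEdges : e ∈ alongEdges f s ↔ f (endpoint s e) = endpoint s.opp e := by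
  simp [alongEdges]

theorem mem_edges_and_tight_of_mem_alongEdges (hfp : ∀ q, G.SlackPartner p q (f q))
    (he : e ∈ alongEdges f s) :
    e ∈ G.edges ∧ p (.inl e.1) + p (.inr e.2) = G.weight e := by
  have hfe := mem_alongEdges.1 he
  obtain ⟨h, -⟩ | ⟨e', he', ht, hj⟩ := hfe ▸ hfp (endpoint s e)
  · exact absurd (by simpa using congrArg sideOf h) s.ne_opp
  · obtain rfl : e = e' := endpoint_ext s (by simpa using hj.eq_endpoint)
      (by simpa using hj.symm.eq_endpoint)
    exact ⟨he', ht⟩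

theorem isMatching_alongEdges (hf : Function.Injective f) (hfp : ∀ q, G.SlackPartner p q (f q)) :
    G.IsMatching (alongEdges f s) := by
  refine ⟨fun e he => (mem_edges_and_tight_of_mem_alongEdges hfp he).1, fun a ha b hb hab => ?_⟩
  rw [mem_alongEdges] at ha hb
  obtain ⟨t, ht⟩ : ∃ t, endpoint t a = endpoint t b :=
    hab.elim (fun h => ⟨.left, congrArg Sum.inl h⟩) fun h => ⟨.right, congrArg Sum.inr h⟩
  obtain rfl | rfl := s.eq_or_eq_opp t
  · exact endpoint_ext t ht (by rw [← ha, ← hb, ht])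
  · exact endpoint_ext s (hf (by rw [ha, hb, ht])) ht

open Classical in
theorem totalWeight_alongEdges (hfp : ∀ q, G.SlackPartner p q (f q)) :
    G.totalWeight (alongEdges f s) = ∑ q with sideOf q = s, (p q + p (f q)) := by
  have hinj : Set.InjOn (endpoint s) (alongEdges f s : Set (U × V)) := fun a ha b hb h =>
    endpoint_ext s h (by rw [← mem_alongEdges.1 ha, ← mem_alongEdges.1 hb, h])
  calc G.totalWeight (alongEdges f s)
      = ∑ e ∈ alongEdges f s, (p (endpoint s e) + p (f (endpoint s e))) :=
        Finset.sum_congr rfl fun e he => by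
          rw [mem_alongEdges.1 he, ← (joins_endpoint s e).add_eq,
            (mem_edges_and_tight_of_mem_alongEdges hfp he).2]
    _ = ∑ q ∈ (alongEdges f s).image (endpoint s), (p q + p (f q)) :=
        (Finset.sum_image (f := fun q => p q + p (f q)) hinj).symm
    _ = _ := by
        refine Finset.sum_subset (fun q hq => ?_) fun q hq hq' => ?_
        · obtain ⟨e, -, rfl⟩ := Finset.mem_image.1 hq
          simp
        · obtain rfl : sideOf q = s := by simpa using hq
          obtain ⟨h, h0⟩ | ⟨e, -, -, hj⟩ := hfp q
          · rw [← h, h0, add_zero]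
          · refine absurd (Finset.mem_image.2 ⟨e, mem_alongEdges.2 ?_, hj.eq_endpoint.symm⟩) hq'
            rw [← hj.eq_endpoint, ← hj.sideOf_eq]
            exact hj.symm.eq_endpoint

theorem totalWeight_alongEdges_add (hf : Function.Injective f)
    (hfp : ∀ q, G.SlackPartner p q (f q)) :
    G.totalWeight (alongEdges f .left) + G.totalWeight (alongEdges f .right) =
      ∑ q, p q + ∑ q, p q := by
  classical
  have hright (q : U ⊕ V) : sideOf q = .right ↔ ¬ sideOf q = .left := by cases q <;> simp [sideOf]
  rw [totalWeight_alongEdges hfp, totalWeight_alongEdges hfp]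
  simp only [hright]
  rw [Finset.sum_filter_add_sum_filter_not, Finset.sum_add_distrib,
    (Finite.injective_iff_bijective.1 hf).sum_comp p]

theorem exists_isCore (G : AssignmentGame U V) : ∃ p, G.IsCore p := by
  classical
  obtain ⟨p, hp, hmin⟩ := G.exists_isMinOn_isCover
  obtain ⟨f, hf, hf'⟩ := (Finset.all_card_le_biUnion_card_iff_exists_injective _).1
    (hp.card_le_card_biUnion_slackPartner hmin)
  have hfp (q : U ⊕ V) : G.SlackPartner p q (f q) := by simpa using hf' q
  have htotal := totalWeight_alongEdges_add hf hfp
  obtain ⟨s, hs⟩ : ∃ s, ∑ q, p q ≤ G.totalWeight (alongEdges f s) := by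
    by_contra! h
    linarith [h .left, h .right]
  exact ⟨p, hp.isCore_of_sum_le (isMatching_alongEdges hf hfp) hs⟩

end Nonempty

/-! ### Components and gains -/

section Components

variable {U V : Type*} {G : AssignmentGame U V} {p z : U ⊕ V → ℝ} {s t : Side}
  {D : Set (U ⊕ V)} {T : Set (U × V)} {e : U × V} {q r x y : U ⊕ V}

theorem eq_of_connectedComponentMk_eq {α : Type*} (f : U ⊕ V → α)
    (hf : ∀ e ∈ T, f (.inl e.1) = f (.inr e.2))
    (h : (subgraphOf T).connectedComponentMk q = (subgraphOf T).connectedComponentMk r) :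
    f q = f r := by
  obtain ⟨w⟩ := SimpleGraph.ConnectedComponent.eq.1 h
  induction w with
  | nil => rfl
  | cons hadj w ih =>
    obtain ⟨e, he, hj⟩ := hadj
    exact (Joins.apply_eq hj (hf e he)).trans (ih (SimpleGraph.ConnectedComponent.eq.2 ⟨w⟩))

theorem connectedComponentMk_eq (he : e ∈ T) :
    (subgraphOf T).connectedComponentMk (.inl e.1) =
      (subgraphOf T).connectedComponentMk (.inr e.2) :=
  SimpleGraph.ConnectedComponent.eq.2 (SimpleGraph.Adj.reachable ⟨e, he, joins_self e⟩)

theorem exists_compOf_eq (C : G.Comp) : ∃ q, G.compOf q = C := C.exists_rep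

theorem compOf_eq (he : e ∈ G.startEdges) : G.compOf (.inl e.1) = G.compOf (.inr e.2) :=
  connectedComponentMk_eq he

theorem HasMinIn.eq_of_attainsMin (hs : G.HasMinIn p s D) (ht : G.AttainsMin p t D) : t = s := by
  obtain h | rfl := s.eq_or_eq_opp t
  · exact h
  · refine absurd ?_ hs.1
    cases s
    exacts [⟨hs.2, ht⟩, ⟨ht, hs.2⟩]

open Classical in
/-- The signed change from `p` to `z` at `q`, counted positively on the side `s` and negatively on
the other side. Between core imputations it is constant on the components of the starting tight
subgraph. -/
noncomputable def gain (s : Side) (z p : U ⊕ V → ℝ) (q : U ⊕ V) : ℝ :=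
  if sideOf q = s then z q - p q else p q - z q

theorem gain_of_eq (z p : U ⊕ V → ℝ) (h : sideOf q = s) : gain s z p q = z q - p q := if_pos h

theorem gain_of_eq_opp (z p : U ⊕ V → ℝ) (h : sideOf q = s.opp) : gain s z p q = p q - z q :=
  if_neg (h ▸ s.ne_opp.symm)

theorem gain_opp (s : Side) (z p : U ⊕ V → ℝ) (q : U ⊕ V) :
    gain s.opp z p q = -gain s z p q := by
  obtain h | h := s.eq_or_eq_opp (sideOf q)
  · rw [gain_of_eq z p h, gain_of_eq_opp z p (s := s.opp) (by simpa using h)]; ring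
  · rw [gain_of_eq z p h, gain_of_eq_opp z p h]; ring

theorem gain_eq_zero_iff : gain s z p q = 0 ↔ z q = p q := by
  obtain h | h := s.eq_or_eq_opp (sideOf q)
  · rw [gain_of_eq z p h, sub_eq_zero]
  · rw [gain_of_eq_opp z p h, sub_eq_zero, eq_comm]

theorem EssentialVertex.exists_sideOf_eq (hq : G.EssentialVertex q) (s : Side) :
    ∃ r, G.compOf r = G.compOf q ∧ sideOf r = s := by
  obtain ⟨M, hM⟩ := G.exists_isMaxMatching
  obtain ⟨e, he, hqe⟩ := hq M hM
  have hcomp := compOf_eq (hM.mem_startEdges he)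
  obtain ⟨rfl, rfl⟩ | ⟨rfl, rfl⟩ | ⟨rfl, rfl⟩ | ⟨rfl, rfl⟩ :
      (q = .inl e.1 ∧ s = .left) ∨ (q = .inl e.1 ∧ s = .right) ∨
        (q = .inr e.2 ∧ s = .left) ∨ (q = .inr e.2 ∧ s = .right) := by
    cases s <;> simpa using hqe
  exacts [⟨_, rfl, rfl⟩, ⟨_, hcomp.symm, rfl⟩, ⟨_, hcomp, rfl⟩, ⟨_, rfl, rfl⟩]

variable [Fintype U] [Fintype V]

theorem gain_le_gain_of_joins (hz : G.IsCore z) (he : e ∈ G.edges)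
    (ht : p (.inl e.1) + p (.inr e.2) = G.weight e) (h : Joins e x y) :
    gain (sideOf y) z p x ≤ gain (sideOf y) z p y := by
  have hcover := hz.isCover.weight_le e he
  rw [← ht, h.add_eq, h.add_eq] at hcover
  rw [gain_of_eq z p rfl, gain_of_eq_opp z p h.symm.sideOf_eq]
  linarith

theorem gain_eq_gain (hz : G.IsCore z) (hp : G.IsCore p) (s : Side)
    (h : G.compOf q = G.compOf r) : gain s z p q = gain s z p r := by
  refine eq_of_connectedComponentMk_eq (T := G.startEdges) _ (fun e he => ?_) h
  have hright (t : Side) (ht : sideOf (Sum.inr e.2 : U ⊕ V) = t) :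
      gain t z p (.inl e.1) = gain t z p (.inr e.2) := by
    rw [gain_of_eq z p ht, gain_of_eq_opp z p (ht ▸ rfl)]
    linarith [hz.tight he, hp.tight he]
  obtain hs | hs := s.eq_or_eq_opp (sideOf (Sum.inr e.2 : U ⊕ V))
  · exact hright s hs
  · have hopp := hright s.opp hs
    rwa [gain_opp, gain_opp, neg_inj] at hopp

theorem essentialVertex_of_not_uniqueImputation (h : ¬ G.UniqueImputation (G.compOf q)) :
    G.EssentialVertex q := by
  by_contra hq
  refine h fun p p' hp hp' r hr => ?_
  have hgain := gain_eq_gain hp hp' .left (show G.compOf q = G.compOf r from hr.symm)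
  rwa [gain_eq_zero_iff.2 (by rw [hp.eq_zero hq, hp'.eq_zero hq]), eq_comm,
    gain_eq_zero_iff] at hgain

end Components

section MinShare

variable {U V : Type*} [Finite U] [Finite V] {G : AssignmentGame U V} {D : Set (U ⊕ V)}
  {q r : U ⊕ V}

theorem minShare_le (p : U ⊕ V → ℝ) (hq : q ∈ D) (he : G.EssentialVertex q) :
    G.minShare p D ≤ p q :=
  csInf_le (Set.toFinite _).bddBelow ⟨q, ⟨hq, he⟩, rfl⟩

theorem exists_eq_minShare (p : U ⊕ V → ℝ) (hq : q ∈ D) (he : G.EssentialVertex q) :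
    ∃ r ∈ D, G.EssentialVertex r ∧ p r = G.minShare p D := by
  have hne : (p '' {q | q ∈ D ∧ G.EssentialVertex q}).Nonempty := ⟨_, q, ⟨hq, he⟩, rfl⟩
  obtain ⟨r, hr, h⟩ := hne.csInf_mem (Set.toFinite _)
  exact ⟨r, hr.1, hr.2, h⟩

theorem minShare_eq {p : U ⊕ V → ℝ} {m : ℝ} (hle : ∀ q ∈ D, G.EssentialVertex q → m ≤ p q)
    (hr : r ∈ D) (he : G.EssentialVertex r) (h : p r = m) : G.minShare p D = m := by
  obtain ⟨t, ht, het, htD⟩ := exists_eq_minShare p hr he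
  exact le_antisymm (h ▸ minShare_le p hr he) (htD ▸ hle t ht het)

end MinShare

/-! ### The invariant -/

section Rigidity

variable {U V : Type*}

/-- `z` is at least `θ` wherever it differs from `p`. -/
def DiffersAbove (θ : ℝ) (p z : U ⊕ V → ℝ) : Prop := ∀ q, θ ≤ z q ∨ z q = p q

/-- No core imputation can leave `p` on the component `C` without moving some vertex to a profit
below `θ`. -/
def Rigid [Fintype U] [Fintype V] (G : AssignmentGame U V) (p : U ⊕ V → ℝ) (θ : ℝ)
    (C : G.Comp) : Prop :=
  ∀ z, G.IsCore z → DiffersAbove θ p z → ∀ q, G.compOf q = C → z q = p q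

theorem DiffersAbove.mono {θ θ' : ℝ} {p z : U ⊕ V → ℝ} (h : DiffersAbove θ' p z) (hθ : θ ≤ θ') :
    DiffersAbove θ p z := fun q => (h q).imp_left hθ.trans

theorem DiffersAbove.le_of_eq {θ : ℝ} {p z : U ⊕ V → ℝ} (h : DiffersAbove θ p z) {q : U ⊕ V}
    (hq : p q = θ) : p q ≤ z q :=
  (h q).elim hq.trans_le Eq.ge

end Rigidity

/-- In Bin or in Active. -/
def Status.Unsettled (st : Status) : Prop := st = .bin ∨ st = .active

namespace State

section Trees

variable {U V : Type*} {G : AssignmentGame U V} {σ : State G} {root : G.Comp → G.Comp}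
  {e : U × V} {q r x y : U ⊕ V} {A B C : G.Comp} {s t : Side}

/-- `C` belongs to a tree in Active with root `C₀`, whose entry sides are sides on which the
minimum `Ω` is attained in `C₀`; the edge to `C` from its parent ends on these sides. In particular
there is only one entry side when `C` is not the root. -/
structure InTree (σ : State G) (C₀ C : G.Comp) : Prop where
  root_active : σ.status C₀ = .active
  parent_root : σ.parent C₀ = none
  descendent : σ.Descendent C₀ C
  parent_edge : ∀ A, σ.parent C = some A → ∃ e ∈ σ.T, ∃ x y, Joins e x y ∧ G.compOf x = A ∧
    G.compOf y = C ∧ ∀ s ∈ σ.entrySides C₀, sideOf y = s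
  entry_nonempty : (σ.entrySides C₀).Nonempty
  entry_attained : ∀ s ∈ σ.entrySides C₀,
    ∃ r, G.compOf r = C₀ ∧ sideOf r = s ∧ σ.profit r = σ.Ω

/-- `root` assigns to every component in Active the root of its tree. -/
structure IsForest (σ : State G) (root : G.Comp → G.Comp) : Prop where
  inTree : ∀ C, σ.status C = .active → σ.InTree (root C) C
  root_eq : ∀ e ∈ σ.T, σ.status (G.compOf (.inl e.1)) = .active →
    root (G.compOf (.inl e.1)) = root (G.compOf (.inr e.2))

/-- The invariant of the mechanism. -/
structure Valid [Fintype U] [Fintype V] (σ : State G) : Prop where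
  core : G.IsCore σ.profit
  nonneg : 0 ≤ σ.Ω
  start_subset : G.startEdges ⊆ σ.T
  mem_edges : ∀ e ∈ σ.T, e ∈ G.edges
  tight : ∀ e ∈ σ.T, σ.profit (.inl e.1) + σ.profit (.inr e.2) = G.weight e
  status_eq : ∀ e ∈ σ.T, σ.status (G.compOf (.inl e.1)) = σ.status (G.compOf (.inr e.2))
  ne_bin : ∀ e ∈ σ.T, e ∉ G.startEdges → σ.status (G.compOf (.inl e.1)) ≠ .bin
  fundamental : ∀ C, (σ.status C).Unsettled → ¬ G.UniqueImputation C
  le_profit : ∀ q, (σ.status (G.compOf q)).Unsettled → σ.Ω ≤ σ.profit q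
  exists_forest : ∃ root, σ.IsForest root
  rigid : ∀ C, ¬ (σ.status C).Unsettled → ∃ θ ≤ σ.Ω,
    (∀ q, G.compOf q = C → G.EssentialVertex q → θ ≤ σ.profit q) ∧ G.Rigid σ.profit θ C

theorem mem_component : r ∈ σ.component q ↔
    (subgraphOf σ.T).connectedComponentMk r = (subgraphOf σ.T).connectedComponentMk q := Iff.rfl

theorem mem_component_self (σ : State G) (q : U ⊕ V) : q ∈ σ.component q := rfl

theorem component_eq (h : r ∈ σ.component q) : σ.component r = σ.component q := by
  rw [component, mem_component.1 h, component]

theorem mem_component_of_joins (h : Joins e x y) (he : e ∈ σ.T) : y ∈ σ.component x :=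
  (h.apply_eq (connectedComponentMk_eq he)).symm

end Trees

namespace Valid

variable {U V : Type*} [Fintype U] [Fintype V] {G : AssignmentGame U V} {σ : State G}
  {root : G.Comp → G.Comp} {e : U × V} {a b q r x : U ⊕ V} {A B C : G.Comp} {s t : Side}
  {z : U ⊕ V → ℝ} (hσ : σ.Valid)
include hσ

theorem mem_component_of_compOf_eq (h : G.compOf r = G.compOf q) : r ∈ σ.component q :=
  eq_of_connectedComponentMk_eq (T := G.startEdges) _
    (fun _ he => connectedComponentMk_eq (hσ.start_subset he)) h

theorem compOf_mem_parts : G.compOf r ∈ G.parts (σ.component q) ↔ r ∈ σ.component q := by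
  refine ⟨fun h => h (show r ∈ (G.compOf r).supp from rfl), fun h t ht => ?_⟩
  rw [← component_eq h]
  exact hσ.mem_component_of_compOf_eq ht

theorem status_eq_of_mem (h : r ∈ σ.component q) :
    σ.status (G.compOf r) = σ.status (G.compOf q) :=
  eq_of_connectedComponentMk_eq (fun q => σ.status (G.compOf q)) hσ.status_eq h

theorem status_eq_of_mem_parts (h : C ∈ G.parts (σ.component q)) :
    σ.status C = σ.status (G.compOf q) := by
  obtain ⟨r, rfl⟩ := exists_compOf_eq C
  exact hσ.status_eq_of_mem (hσ.compOf_mem_parts.1 h)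

theorem compOf_mem_parts_iff (he : e ∈ σ.T) :
    G.compOf (.inl e.1) ∈ G.parts (σ.component q) ↔
      G.compOf (.inr e.2) ∈ G.parts (σ.component q) := by
  rw [hσ.compOf_mem_parts, hσ.compOf_mem_parts, mem_component, mem_component,
    connectedComponentMk_eq he]

theorem unsettled_of_mem (hx : σ.status (G.compOf x) = .active) (hq : q ∈ σ.component x) :
    (σ.status (G.compOf q)).Unsettled :=
  .inr ((hσ.status_eq_of_mem hq).trans hx)

theorem essentialVertex (h : (σ.status (G.compOf q)).Unsettled) : G.EssentialVertex q :=
  essentialVertex_of_not_uniqueImputation (hσ.fundamental _ h)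

theorem root_eq_of_mem (hr : σ.IsForest root) (h : r ∈ σ.component q)
    (hq : σ.status (G.compOf q) = .active) : root (G.compOf r) = root (G.compOf q) := by
  classical
  let activeRoot (q : U ⊕ V) : Option G.Comp :=
    if σ.status (G.compOf q) = .active then some (root (G.compOf q)) else none
  have hedge (e : U × V) (he : e ∈ σ.T) : activeRoot (.inl e.1) = activeRoot (.inr e.2) := by
    by_cases hactive : σ.status (G.compOf (.inl e.1)) = .active
    · simp [activeRoot, hactive, ← hσ.status_eq e he, hr.root_eq e he hactive]
    · simp [activeRoot, hactive, ← hσ.status_eq e he]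
  simpa [activeRoot, hq, hσ.status_eq_of_mem h] using eq_of_connectedComponentMk_eq _ hedge h

theorem mem_component_of_descendent (hr : σ.IsForest root)
    (h : σ.Descendent (G.compOf a) (G.compOf b)) (hb : σ.status (G.compOf b) = .active) :
    a ∈ σ.component b := by
  generalize hB : G.compOf b = B at h hb
  induction h generalizing b with
  | refl => exact hσ.mem_component_of_compOf_eq hB.symm
  | tail _ hparent ih =>
    obtain ⟨e, he, x, y, hxy, rfl, rfl, -⟩ := (hr.inTree _ hb).parent_edge _ hparent
    have hx : x ∈ σ.component y := mem_component_of_joins hxy.symm he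
    have ha := ih rfl ((hσ.status_eq_of_mem hx).trans hb)
    rwa [component_eq hx, component_eq (hσ.mem_component_of_compOf_eq hB.symm)] at ha

theorem gain_le_gain_of_descendent (hr : σ.IsForest root) (hz : G.IsCore z)
    (h : σ.Descendent (G.compOf a) (G.compOf b)) (hb : σ.status (G.compOf b) = .active)
    (hs : s ∈ σ.entrySides (root (G.compOf b))) :
    gain s z σ.profit a ≤ gain s z σ.profit b := by
  generalize hB : G.compOf b = B at h hb hs
  induction h generalizing b with
  | refl => exact (gain_eq_gain hz hσ.core s hB.symm).le
  | tail _ hparent ih =>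
    obtain ⟨e, he, x, y, hxy, rfl, rfl, hside⟩ := (hr.inTree _ hb).parent_edge _ hparent
    have hx : x ∈ σ.component y := mem_component_of_joins hxy.symm he
    obtain rfl := hside s hs
    calc gain (sideOf y) z σ.profit a
        ≤ gain (sideOf y) z σ.profit x :=
          ih rfl ((hσ.status_eq_of_mem hx).trans hb) (hσ.root_eq_of_mem hr hx hb ▸ hs)
      _ ≤ gain (sideOf y) z σ.profit y :=
          gain_le_gain_of_joins hz (hσ.mem_edges e he) (hσ.tight e he) hxy
      _ = gain (sideOf y) z σ.profit b := gain_eq_gain hz hσ.core _ hB.symm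

theorem isRoot_root (hr : σ.IsForest root) (hx : σ.status (G.compOf x) = .active) :
    σ.IsRoot (σ.component x) (root (G.compOf x)) := by
  refine ⟨?_, fun B hB => ?_⟩
  · obtain ⟨r, hrx⟩ := exists_compOf_eq (root (G.compOf x))
    rw [← hrx, hσ.compOf_mem_parts]
    exact hσ.mem_component_of_descendent hr (hrx ▸ (hr.inTree _ hx).descendent) hx
  · obtain ⟨b, rfl⟩ := exists_compOf_eq B
    rw [hσ.compOf_mem_parts] at hB
    rw [← hσ.root_eq_of_mem hr hB hx]
    exact (hr.inTree _ ((hσ.status_eq_of_mem hB).trans hx)).descendent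

theorem eq_root_of_isRoot (hr : σ.IsForest root) (hx : σ.status (G.compOf x) = .active)
    (h : σ.IsRoot (σ.component x) C) : C = root (G.compOf x) := by
  obtain heq | ⟨B, -, hparent⟩ :=
    Relation.ReflTransGen.cases_tail (h.2 _ (hσ.isRoot_root hr hx).1)
  · exact heq.symm
  · cases (hr.inTree _ hx).parent_root.symm.trans hparent

theorem exists_mem_component_of_mem_entrySides (hr : σ.IsForest root)
    (hx : σ.status (G.compOf x) = .active) (hs : s ∈ σ.entrySides (root (G.compOf x))) :
    ∃ r ∈ σ.component x, G.compOf r = root (G.compOf x) ∧ sideOf r = s ∧ σ.profit r = σ.Ω := by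
  obtain ⟨r, hrx, hside, hΩ⟩ := (hr.inTree _ hx).entry_attained s hs
  refine ⟨r, hσ.compOf_mem_parts.1 ?_, hrx, hside, hΩ⟩
  exact hrx ▸ (hσ.isRoot_root hr hx).1

theorem minShare_component (hx : σ.status (G.compOf x) = .active) :
    G.minShare σ.profit (σ.component x) = σ.Ω := by
  obtain ⟨root, hr⟩ := hσ.exists_forest
  obtain ⟨s, hs⟩ := (hr.inTree _ hx).entry_nonempty
  obtain ⟨r, hrx, -, -, hΩ⟩ := hσ.exists_mem_component_of_mem_entrySides hr hx hs
  exact minShare_eq (fun q hq _ => hσ.le_profit q (hσ.unsettled_of_mem hx hq)) hrx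
    (hσ.essentialVertex (hσ.unsettled_of_mem hx hrx)) hΩ

theorem attainsMin_iff (hx : σ.status (G.compOf x) = .active) :
    G.AttainsMin σ.profit s (σ.component x) ↔
      ∃ q ∈ σ.component x, sideOf q = s ∧ σ.profit q = σ.Ω := by
  rw [AttainsMin, hσ.minShare_component hx]
  exact ⟨fun ⟨q, hq, h⟩ => ⟨q, hq.1, hq.2.2, h⟩, fun ⟨q, hq, hs, h⟩ =>
    ⟨q, ⟨hq, hσ.essentialVertex (hσ.unsettled_of_mem hx hq), hs⟩, h⟩⟩

theorem attainsMin_of_mem_entrySides (hr : σ.IsForest root)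
    (hx : σ.status (G.compOf x) = .active) (hs : s ∈ σ.entrySides (root (G.compOf x))) :
    G.AttainsMin σ.profit s (σ.component x) := by
  obtain ⟨r, hrx, -, hside, hΩ⟩ := hσ.exists_mem_component_of_mem_entrySides hr hx hs
  exact (hσ.attainsMin_iff hx).2 ⟨r, hrx, hside, hΩ⟩

theorem mem_entrySides_iff (hr : σ.IsForest root) (hx : σ.status (G.compOf x) = .active)
    (hs : G.HasMinIn σ.profit s (σ.component x)) :
    t ∈ σ.entrySides (root (G.compOf x)) ↔ t = s := by
  have hmem {t : Side} (ht : t ∈ σ.entrySides (root (G.compOf x))) : t = s :=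
    hs.eq_of_attainsMin (hσ.attainsMin_of_mem_entrySides hr hx ht)
  refine ⟨hmem, ?_⟩
  rintro rfl
  obtain ⟨t', ht'⟩ := (hr.inTree _ hx).entry_nonempty
  exact hmem ht' ▸ ht'

theorem exists_hasMinIn (hx : σ.status (G.compOf x) = .active)
    (h : ¬ G.MinOnBoth σ.profit (σ.component x)) :
    ∃ s, G.HasMinIn σ.profit s (σ.component x) := by
  obtain ⟨root, hr⟩ := hσ.exists_forest
  obtain ⟨s, hs⟩ := (hr.inTree _ hx).entry_nonempty
  exact ⟨s, h, hσ.attainsMin_of_mem_entrySides hr hx hs⟩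

variable (hz : G.IsCore z) (hle : DiffersAbove σ.Ω σ.profit z)
include hz hle

-- The gain is nonnegative at a vertex of the root with profit `Ω`, and grows down the tree.
theorem gain_nonneg (hr : σ.IsForest root) (hq : σ.status (G.compOf q) = .active)
    (hs : s ∈ σ.entrySides (root (G.compOf q))) : 0 ≤ gain s z σ.profit q := by
  obtain ⟨r, hroot, hside, hΩ⟩ := (hr.inTree _ hq).entry_attained s hs
  calc 0 ≤ gain s z σ.profit r := by
        rw [gain_of_eq z _ hside]
        exact sub_nonneg.2 (hle.le_of_eq hΩ)
    _ ≤ gain s z σ.profit q :=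
        hσ.gain_le_gain_of_descendent hr hz (hroot ▸ (hr.inTree _ hq).descendent) hq hs

theorem eq_of_gain_nonpos (hr : σ.IsForest root) (hq : σ.status (G.compOf q) = .active)
    (hs : s ∈ σ.entrySides (root (G.compOf q))) (h : gain s z σ.profit q ≤ 0)
    (hd : σ.Descendent (G.compOf r) (G.compOf q)) : z r = σ.profit r := by
  have hmem := hσ.mem_component_of_descendent hr hd hq
  refine gain_eq_zero_iff.1 (le_antisymm ?_ (hσ.gain_nonneg hz hle hr
    ((hσ.status_eq_of_mem hmem).trans hq) (hσ.root_eq_of_mem hr hmem hq ▸ hs)))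
  exact (hσ.gain_le_gain_of_descendent hr hz hd hq hs).trans h

end Valid
end State

namespace State

/-! ### Changes of state -/

variable {U V : Type*} {G : AssignmentGame U V} {σ σ' : State G} {root : G.Comp → G.Comp}
  {Q : Set G.Comp} {A B C r : G.Comp}

/-- `Q` is a set of components closed under taking parents, and the passage from `σ` to `σ'` does
not touch the trees within `Q`. -/
structure Preserves (σ σ' : State G) (Q : Set G.Comp) : Prop where
  profit_eq : σ'.profit = σ.profit
  Ω_eq : σ'.Ω = σ.Ω
  parent_mem : ∀ A, ∀ B ∈ Q, σ.parent B = some A → A ∈ Q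
  status_eq : ∀ C ∈ Q, σ'.status C = σ.status C
  parent_eq : ∀ C ∈ Q, σ'.parent C = σ.parent C
  entrySides_eq : ∀ C ∈ Q, σ'.entrySides C = σ.entrySides C
  mem_T : ∀ e ∈ σ.T, ∀ x y, Joins e x y → G.compOf y ∈ Q → e ∈ σ'.T

theorem Preserves.descendent (h : σ.Preserves σ' Q) (hd : σ.Descendent A B) (hB : B ∈ Q) :
    A ∈ Q ∧ σ'.Descendent A B := by
  induction hd with
  | refl => exact ⟨hB, .refl⟩
  | tail _ hparent ih =>
    obtain ⟨hA, hd⟩ := ih (h.parent_mem _ _ hB hparent)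
    exact ⟨hA, hd.tail ((h.parent_eq _ hB).trans hparent)⟩

theorem InTree.of_preserves (hC : σ.InTree r C) (h : σ.Preserves σ' Q) (hQ : C ∈ Q) :
    σ'.InTree r C := by
  obtain ⟨hrQ, hdesc⟩ := h.descendent hC.descendent hQ
  refine ⟨(h.status_eq r hrQ).trans hC.root_active, (h.parent_eq r hrQ).trans hC.parent_root,
    hdesc, fun A hA => ?_, ?_, ?_⟩
  · obtain ⟨e, he, x, y, hxy, hx, hy, hside⟩ := hC.parent_edge A (h.parent_eq C hQ ▸ hA)
    exact ⟨e, h.mem_T e he x y hxy (hy ▸ hQ), x, y, hxy, hx, hy, h.entrySides_eq r hrQ ▸ hside⟩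
  · exact h.entrySides_eq r hrQ ▸ hC.entry_nonempty
  · rw [h.entrySides_eq r hrQ, h.profit_eq, h.Ω_eq]
    exact hC.entry_attained

theorem Valid.status_parent [Fintype U] [Fintype V] (hσ : σ.Valid) (hr : σ.IsForest root)
    (hB : σ.status B = .active) (h : σ.parent B = some A) : σ.status A = .active := by
  obtain ⟨e, he, x, y, hxy, rfl, rfl, -⟩ := (hr.inTree B hB).parent_edge A h
  exact (hσ.status_eq_of_mem (mem_component_of_joins hxy.symm he)).trans hB

/-- `σ'` arises from `σ` by moving the component `C` from Bin to Active, possibly along added edges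
which connect `C` to components in Active. -/
structure MovesToActive (σ σ' : State G) (C : G.Comp) : Prop where
  profit_eq : σ'.profit = σ.profit
  Ω_eq : σ'.Ω = σ.Ω
  bin : σ.status C = .bin
  status_self : σ'.status C = .active
  status_of_ne : ∀ D, D ≠ C → σ'.status D = σ.status D
  parent_of_ne : ∀ D, D ≠ C → σ'.parent D = σ.parent D
  entrySides_of_ne : ∀ D, D ≠ C → σ'.entrySides D = σ.entrySides D
  subset_T : σ.T ⊆ σ'.T
  new_edge : ∀ e ∈ σ'.T, e ∉ σ.T → e ∈ G.edges ∧
    σ.profit (.inl e.1) + σ.profit (.inr e.2) = G.weight e ∧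
    ∃ x y, Joins e x y ∧ σ.status (G.compOf x) = .active ∧ G.compOf y = C

namespace MovesToActive

variable (h : σ.MovesToActive σ' C) {D : G.Comp} {e : U × V}
include h

theorem ne_of_active (hD : σ.status D = .active) : D ≠ C := by
  rintro rfl
  cases h.bin.symm.trans hD

theorem active (hD : σ.status D = .active) : σ'.status D = .active :=
  (h.status_of_ne D (h.ne_of_active hD)).trans hD

theorem eq_or_active (hD : σ'.status D = .active) : D = C ∨ D ≠ C ∧ σ.status D = .active := by
  by_cases hDC : D = C
  · exact .inl hDC
  · exact .inr ⟨hDC, h.status_of_ne D hDC ▸ hD⟩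

theorem unsettled_iff : (σ'.status D).Unsettled ↔ (σ.status D).Unsettled := by
  by_cases hDC : D = C
  · subst hDC
    exact iff_of_true (.inr h.status_self) (.inl h.bin)
  · rw [h.status_of_ne D hDC]

theorem active_of_new_edge (he : e ∈ σ'.T) (he' : e ∉ σ.T) :
    σ'.status (G.compOf (.inl e.1)) = .active ∧ σ'.status (G.compOf (.inr e.2)) = .active := by
  obtain ⟨-, -, x, y, hxy, hx, rfl⟩ := h.new_edge e he he'
  obtain ⟨rfl, rfl⟩ | ⟨rfl, rfl⟩ := hxy
  exacts [⟨h.active hx, h.status_self⟩, ⟨h.status_self, h.active hx⟩]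

variable [Fintype U] [Fintype V] (hσ : σ.Valid)
include hσ

theorem eq_iff_eq (he : e ∈ σ.T) : G.compOf (.inl e.1) = C ↔ G.compOf (.inr e.2) = C := by
  by_cases hs : e ∈ G.startEdges
  · rw [compOf_eq hs]
  · have hbin := hσ.ne_bin e he hs
    refine iff_of_false (fun hC => hbin (hC ▸ h.bin)) fun hC => hbin ?_
    rw [hσ.status_eq e he, hC, h.bin]

theorem preserves (hr : σ.IsForest root) : σ.Preserves σ' {D | σ.status D = .active} where
  profit_eq := h.profit_eq
  Ω_eq := h.Ω_eq
  parent_mem _ _ hB := hσ.status_parent hr hB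
  status_eq D hD := h.status_of_ne D (h.ne_of_active hD)
  parent_eq D hD := h.parent_of_ne D (h.ne_of_active hD)
  entrySides_eq D hD := h.entrySides_of_ne D (h.ne_of_active hD)
  mem_T _ he _ _ _ _ := h.subset_T he

open Classical in
theorem isForest_update (hr : σ.IsForest root) (hC : σ'.InTree r C)
    (hnew : ∀ e ∈ σ'.T, e ∉ σ.T → ∀ x y, Joins e x y → σ.status (G.compOf x) = .active →
      root (G.compOf x) = r) :
    σ'.IsForest (Function.update root C r) where
  inTree D hD := by
    obtain rfl | ⟨hne, hD⟩ := h.eq_or_active hD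
    · rwa [Function.update_self]
    · rw [Function.update_of_ne hne]
      exact (hr.inTree D hD).of_preserves (h.preserves hσ hr) hD
  root_eq e he hactive := by
    by_cases heT : e ∈ σ.T
    · have hiff := h.eq_iff_eq hσ heT
      obtain heq | ⟨hne, hD⟩ := h.eq_or_active hactive
      · rw [heq, hiff.1 heq]
      · rw [Function.update_of_ne hne, Function.update_of_ne (mt hiff.2 hne), hr.root_eq e heT hD]
    · obtain ⟨-, -, x, y, hxy, hx, rfl⟩ := h.new_edge e he heT
      have hroot : Function.update root (G.compOf y) r (G.compOf x) =
          Function.update root (G.compOf y) r (G.compOf y) := by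
        rw [Function.update_self, Function.update_of_ne (h.ne_of_active hx),
          hnew e he heT x y hxy hx]
      obtain ⟨rfl, rfl⟩ | ⟨rfl, rfl⟩ := hxy
      exacts [hroot, hroot.symm]

theorem valid (hforest : ∃ root', σ'.IsForest root') : σ'.Valid where
  core := h.profit_eq ▸ hσ.core
  nonneg := h.Ω_eq ▸ hσ.nonneg
  start_subset := hσ.start_subset.trans h.subset_T
  mem_edges e he := by
    by_cases heT : e ∈ σ.T
    exacts [hσ.mem_edges e heT, (h.new_edge e he heT).1]
  tight e he := by
    rw [h.profit_eq]
    by_cases heT : e ∈ σ.T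
    exacts [hσ.tight e heT, (h.new_edge e he heT).2.1]
  status_eq e he := by
    by_cases heT : e ∈ σ.T
    · have hiff := h.eq_iff_eq hσ heT
      by_cases hC : G.compOf (.inl e.1) = C
      · rw [hC, hiff.1 hC]
      · rw [h.status_of_ne _ hC, h.status_of_ne _ (mt hiff.2 hC), hσ.status_eq e heT]
    · obtain ⟨hl, hr⟩ := h.active_of_new_edge he heT
      rw [hl, hr]
  ne_bin e he hs := by
    by_cases heT : e ∈ σ.T
    · by_cases hC : G.compOf (.inl e.1) = C
      · simp [hC, h.status_self]
      · rw [h.status_of_ne _ hC]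
        exact hσ.ne_bin e heT hs
    · simp [(h.active_of_new_edge he heT).1]
  fundamental D hD := hσ.fundamental D (h.unsettled_iff.1 hD)
  le_profit q hq := by
    rw [h.profit_eq, h.Ω_eq]
    exact hσ.le_profit q (h.unsettled_iff.1 hq)
  exists_forest := hforest
  rigid D hD := by
    rw [h.profit_eq, h.Ω_eq]
    exact hσ.rigid D (mt h.unsettled_iff.2 hD)

end MovesToActive

namespace Legitimate

variable {e : U × V} {x y : U ⊕ V} (he : σ.Legitimate e x y)
include he

theorem joins : Joins e x y := he.2.1

theorem active : σ.status (G.compOf x) = .active := he.2.2.2.1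

theorem hasMinIn : G.HasMinIn σ.profit (sideOf y) (σ.component x) := by
  obtain ⟨-, -, -, -, s, hs, hxs⟩ := he.2
  rwa [he.joins.sideOf_eq, hxs.2.2, s.opp_opp]

end Legitimate

namespace Valid

variable [Fintype U] [Fintype V] {e : U × V} {x y : U ⊕ V} (hσ : σ.Valid)
include hσ

theorem activate (hC : σ.status C = .bin) (hmin : G.minShare σ.profit C.supp = σ.Ω)
    (h : σ.MovesToActive σ' C) (hparent : σ'.parent C = none)
    (hentry : σ'.entrySides C = {s | G.AttainsMin σ.profit s C.supp}) (hT : σ'.T = σ.T) :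
    σ'.Valid := by
  obtain ⟨root, hr⟩ := hσ.exists_forest
  refine h.valid hσ ⟨_, h.isForest_update hσ hr (r := C) ?_ fun e he he' => absurd (hT ▸ he) he'⟩
  obtain ⟨q, hq⟩ := exists_compOf_eq C
  obtain ⟨r, hrC, hess, hrmin⟩ := exists_eq_minShare σ.profit
    (show q ∈ C.supp from hq) (hσ.essentialVertex (hq ▸ .inl hC))
  refine ⟨h.status_self, hparent, .refl, fun A hA => ?_, ?_, ?_⟩
  · cases hparent.symm.trans hA
  · exact hentry ▸ ⟨sideOf r, r, ⟨hrC, hess, rfl⟩, hrmin⟩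
  · rw [hentry, h.profit_eq, h.Ω_eq]
    rintro s ⟨r, hrs, hrm⟩
    exact ⟨r, hrs.1, hrs.2.2, hrm.trans hmin⟩

theorem grow (he : σ.Legitimate e x y) (h : σ.MovesToActive σ' (G.compOf y))
    (hparent : σ'.parent (G.compOf y) = some (G.compOf x)) (hT : σ'.T = insert e σ.T) :
    σ'.Valid := by
  have hxy := he.joins
  have hx := he.active
  obtain ⟨root, hr⟩ := hσ.exists_forest
  have hrx := hr.inTree _ hx
  have hpres := h.preserves hσ hr
  have htree : σ'.InTree (root (G.compOf x)) (G.compOf x) := hrx.of_preserves hpres hx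
  have hentry : σ'.entrySides (root (G.compOf x)) = σ.entrySides (root (G.compOf x)) :=
    hpres.entrySides_eq _ hrx.root_active
  have hside (t : Side) (ht : t ∈ σ.entrySides (root (G.compOf x))) : sideOf y = t :=
    ((hσ.mem_entrySides_iff hr hx he.hasMinIn).1 ht).symm
  refine h.valid hσ ⟨_, h.isForest_update hσ hr (r := root (G.compOf x))
    { htree with
      descendent := htree.descendent.tail hparent
      parent_edge := fun A hA => ?_ } ?_⟩
  · obtain rfl : G.compOf x = A := Option.some.inj (hparent.symm.trans hA)
    exact ⟨e, hT ▸ .inl rfl, x, y, hxy, rfl, rfl, hentry ▸ hside⟩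
  · intro f hf hf' x' y' hxy' hx'
    obtain rfl : f = e := (hT ▸ hf : f ∈ insert e σ.T).resolve_right hf'
    obtain rfl | rfl := hxy.eq_or_eq hxy'
    · rfl
    · exact absurd rfl (h.ne_of_active hx')

end Valid

/-! ### Settling components -/

/-- The conditions under which `settle` with the edge set `T'` may move the part `M` of the set `R`
of components to Frozen or Fully-Repaired. -/
structure CanSettle [Fintype U] [Fintype V] (σ : State G) (T' : Set (U × V)) (R M : Set G.Comp) :
    Prop where
  subset_T : σ.T ⊆ T'
  new_edge : ∀ e ∈ T', e ∉ σ.T → e ∈ G.edges ∧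
    σ.profit (.inl e.1) + σ.profit (.inr e.2) = G.weight e ∧
    G.compOf (.inl e.1) ∈ M ∧ G.compOf (.inr e.2) ∈ M
  subset : M ⊆ R
  mem_iff_mem : ∀ e ∈ σ.T, G.compOf (.inl e.1) ∈ R ↔ G.compOf (.inr e.2) ∈ R
  mem_of_settled : ∀ C ∈ R, ¬ (σ.status C).Unsettled → C ∈ M
  rigid : ∀ C ∈ M, (σ.status C).Unsettled → G.Rigid σ.profit σ.Ω C

section Settle

variable {T' : Set (U × V)} {R M : Set G.Comp} {st : Status} {e : U × V}

theorem status_settle_of_mem (hR : C ∈ R) (hM : C ∈ M) : (σ.settle T' R M st).status C = st :=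
  (if_pos hR).trans (if_pos hM)

theorem status_settle_of_notMem (hR : C ∈ R) (hM : C ∉ M) :
    (σ.settle T' R M st).status C = .bin :=
  (if_pos hR).trans (if_neg hM)

theorem status_settle_of_outside (hR : C ∉ R) : (σ.settle T' R M st).status C = σ.status C :=
  if_neg hR

theorem parent_settle_of_outside (hR : C ∉ R) : (σ.settle T' R M st).parent C = σ.parent C :=
  if_neg fun h => hR h.1

namespace CanSettle

variable [Fintype U] [Fintype V] (h : σ.CanSettle T' R M) (hst : ¬ st.Unsettled)
include h hst

theorem unsettled_iff :
    ((σ.settle T' R M st).status C).Unsettled ↔ (σ.status C).Unsettled ∧ C ∉ M := by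
  by_cases hR : C ∈ R
  · by_cases hM : C ∈ M
    · rw [status_settle_of_mem hR hM]
      exact iff_of_false hst fun hC => hC.2 hM
    · rw [status_settle_of_notMem hR hM]
      exact iff_of_true (.inl rfl) ⟨by_contra fun hC => hM (h.mem_of_settled C hR hC), hM⟩
  · rw [status_settle_of_outside hR, iff_self_and]
    exact fun _ hM => hR (h.subset hM)

theorem active_outside (hC : (σ.settle T' R M st).status C = .active) :
    C ∉ R ∧ σ.status C = .active := by
  have hR : C ∉ R := fun hR => by
    have hM := ((h.unsettled_iff hst).1 (.inr hC)).2
    cases (status_settle_of_notMem hR hM).symm.trans hC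
  exact ⟨hR, status_settle_of_outside hR ▸ hC⟩

omit hst in
theorem mem_or_outside (he : e ∈ (σ.settle T' R M st).T) (hs : e ∉ G.startEdges) :
    (G.compOf (.inl e.1) ∈ M ∧ G.compOf (.inr e.2) ∈ M) ∨
      (e ∈ σ.T ∧ G.compOf (.inl e.1) ∉ R ∧ G.compOf (.inr e.2) ∉ R) := by
  by_cases heT : e ∈ σ.T
  · obtain ⟨hl, hr⟩ := he.2.resolve_left hs
    by_cases hR : G.compOf (.inl e.1) ∈ R
    · have hR' := (h.mem_iff_mem e heT).1 hR
      exact .inl ⟨by_contra fun hM => hl ⟨hR, hM⟩, by_contra fun hM => hr ⟨hR', hM⟩⟩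
    · exact .inr ⟨heT, hR, mt (h.mem_iff_mem e heT).2 hR⟩
  · exact .inl (h.new_edge e he.1 heT).2.2

variable (hσ : σ.Valid)
include hσ

omit hst in
theorem preserves (hr : σ.IsForest root) :
    σ.Preserves (σ.settle T' R M st) {C | C ∉ R ∧ σ.status C = .active} where
  profit_eq := rfl
  Ω_eq := rfl
  parent_mem A B hB hA := by
    refine ⟨fun hR => hB.1 ?_, hσ.status_parent hr hB.2 hA⟩
    obtain ⟨e, he, x, y, hxy, rfl, rfl, -⟩ := (hr.inTree B hB.2).parent_edge A hA
    exact hxy.apply_eq (f := fun q => G.compOf q ∈ R) (propext (h.mem_iff_mem e he)) ▸ hR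
  status_eq C hC := status_settle_of_outside hC.1
  parent_eq C hC := parent_settle_of_outside hC.1
  entrySides_eq _ _ := rfl
  mem_T e he x y hxy hy := by
    have hl : G.compOf (.inl e.1) ∉ R ∧ G.compOf (.inr e.2) ∉ R := by
      have hiff := h.mem_iff_mem e he
      obtain ⟨-, rfl⟩ | ⟨-, rfl⟩ := hxy
      exacts [⟨mt hiff.1 hy.1, hy.1⟩, ⟨hy.1, mt hiff.2 hy.1⟩]
    exact ⟨h.subset_T he, .inr ⟨fun hR => hl.1 hR.1, fun hR => hl.2 hR.1⟩⟩

theorem isForest (hr : σ.IsForest root) : (σ.settle T' R M st).IsForest root where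
  inTree C hC := by
    obtain ⟨hR, hC⟩ := h.active_outside hst hC
    exact (hr.inTree C hC).of_preserves (h.preserves hσ hr) ⟨hR, hC⟩
  root_eq e he hC := by
    obtain ⟨hR, hC⟩ := h.active_outside hst hC
    by_cases heT : e ∈ σ.T
    · exact hr.root_eq e heT hC
    · exact absurd (h.subset (h.new_edge e he.1 heT).2.2.1) hR

theorem valid : (σ.settle T' R M st).Valid where
  core := hσ.core
  nonneg := hσ.nonneg
  start_subset e he := ⟨h.subset_T (hσ.start_subset he), .inl he⟩
  mem_edges e he := by
    by_cases heT : e ∈ σ.T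
    exacts [hσ.mem_edges e heT, (h.new_edge e he.1 heT).1]
  tight e he := by
    by_cases heT : e ∈ σ.T
    exacts [hσ.tight e heT, (h.new_edge e he.1 heT).2.1]
  status_eq e he := by
    by_cases hs : e ∈ G.startEdges
    · rw [compOf_eq hs]
    · obtain ⟨hl, hr⟩ | ⟨heT, hl, hr⟩ := h.mem_or_outside he hs
      · rw [status_settle_of_mem (h.subset hl) hl, status_settle_of_mem (h.subset hr) hr]
      · rw [status_settle_of_outside hl, status_settle_of_outside hr, hσ.status_eq e heT]
  ne_bin e he hs := by
    obtain ⟨hl, -⟩ | ⟨heT, hl, -⟩ := h.mem_or_outside he hs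
    · rw [status_settle_of_mem (h.subset hl) hl]
      exact fun hbin => hst (.inl hbin)
    · rw [status_settle_of_outside hl]
      exact hσ.ne_bin e heT hs
  fundamental C hC := hσ.fundamental C ((h.unsettled_iff hst).1 hC).1
  le_profit q hq := hσ.le_profit q ((h.unsettled_iff hst).1 hq).1
  exists_forest := hσ.exists_forest.imp fun _ => h.isForest hst hσ
  rigid C hC := by
    by_cases hu : (σ.status C).Unsettled
    · have hM : C ∈ M := by_contra fun hM => hC ((h.unsettled_iff hst).2 ⟨hu, hM⟩)
      exact ⟨σ.Ω, le_rfl, fun q hq _ => hσ.le_profit q (hq ▸ hu), h.rigid C hM hu⟩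
    · exact hσ.rigid C hu

end CanSettle
end Settle
end State

namespace State

/-! ### Events -/

variable {U V : Type*} {G : AssignmentGame U V} {σ σ' : State G} {e : U × V} {q x y : U ⊕ V}
  {C : G.Comp}

/-- The termination measure of the events: an event decreases the number of unsettled components,
or keeps it and takes a component out of Bin. -/
noncomputable def potential (σ : State G) : ℕ :=
  {C | (σ.status C).Unsettled}.ncard * (Nat.card G.Comp + 1) + {C | σ.status C = .bin}.ncard

variable [Fintype U] [Fintype V]

/-- What executing an event guarantees. -/
structure Improves (σ σ' : State G) : Prop where
  valid : σ'.Valid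
  profit_eq : σ'.profit = σ.profit
  Ω_eq : σ'.Ω = σ.Ω
  unsettled : ∀ C, (σ'.status C).Unsettled → (σ.status C).Unsettled
  potential_lt : σ'.potential < σ.potential

theorem MovesToActive.improves (h : σ.MovesToActive σ' C) (hvalid : σ'.Valid) :
    σ.Improves σ' where
  valid := hvalid
  profit_eq := h.profit_eq
  Ω_eq := h.Ω_eq
  unsettled _ := h.unsettled_iff.1
  potential_lt := by
    simp only [potential, h.unsettled_iff]
    refine Nat.add_lt_add_left (Set.ncard_lt_ncard ⟨fun D hD => ?_, fun hsub => ?_⟩) _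
    · have hne : D ≠ C := by
        rintro rfl
        cases h.status_self.symm.trans hD
      exact (h.status_of_ne D hne).symm.trans hD
    · cases h.status_self.symm.trans (hsub h.bin)

theorem CanSettle.improves {T' : Set (U × V)} {R M : Set G.Comp} {st : Status}
    (h : σ.CanSettle T' R M) (hst : ¬ st.Unsettled) (hσ : σ.Valid) (hC : C ∈ M)
    (hu : (σ.status C).Unsettled) : σ.Improves (σ.settle T' R M st) where
  valid := h.valid hst hσ
  profit_eq := rfl
  Ω_eq := rfl
  unsettled _ hD := ((h.unsettled_iff hst).1 hD).1
  potential_lt := by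
    have hlt : {D | ((σ.settle T' R M st).status D).Unsettled}.ncard <
        {D | (σ.status D).Unsettled}.ncard :=
      Set.ncard_lt_ncard ⟨fun D hD => ((h.unsettled_iff hst).1 hD).1,
        fun hsub => ((h.unsettled_iff hst).1 (hsub hu)).2 hC⟩
    have hle := Set.ncard_le_card {D | (σ.settle T' R M st).status D = .bin}
    unfold potential
    nlinarith

namespace Valid

variable {root : G.Comp → G.Comp} {z : U ⊕ V → ℝ} {s : Side} {b : U ⊕ V} {A B : G.Comp}
  {st : Status} (hσ : σ.Valid)
include hσ

theorem mem_parts_of_descendent (hx : σ.status (G.compOf x) = .active)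
    (hB : B ∈ G.parts (σ.component x)) (h : σ.Descendent A B) :
    A ∈ G.parts (σ.component x) := by
  obtain ⟨root, hr⟩ := hσ.exists_forest
  obtain ⟨a, rfl⟩ := exists_compOf_eq A
  obtain ⟨b, rfl⟩ := exists_compOf_eq B
  have hb := hσ.compOf_mem_parts.1 hB
  rw [hσ.compOf_mem_parts, ← component_eq hb]
  exact hσ.mem_component_of_descendent hr h ((hσ.status_eq_of_mem hb).trans hx)

theorem rootPath_subset (hx : σ.status (G.compOf x) = .active) :
    σ.rootPath (σ.component x) (G.compOf x) ⊆ G.parts (σ.component x) :=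
  fun _ ⟨_, _, h⟩ =>
    hσ.mem_parts_of_descendent hx (hσ.compOf_mem_parts.2 (σ.mem_component_self x)) h.2

theorem compOf_mem_rootPath (hx : σ.status (G.compOf x) = .active) :
    G.compOf x ∈ σ.rootPath (σ.component x) (G.compOf x) := by
  obtain ⟨root, hr⟩ := hσ.exists_forest
  exact ⟨_, hσ.isRoot_root hr hx, (hr.inTree _ hx).descendent, .refl⟩

theorem minSub1_subset (hx : σ.status (G.compOf x) = .active) :
    σ.minSub1 (σ.component x) ⊆ G.parts (σ.component x) := by
  rintro C ⟨C₀, hroot, rfl | ⟨B, hB, hC⟩⟩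
  · exact hroot.1
  · exact hσ.mem_parts_of_descendent hx hB.1 hC.2

theorem unsettled_of_mem_parts (hx : σ.status (G.compOf x) = .active)
    (hC : C ∈ G.parts (σ.component x)) : (σ.status C).Unsettled :=
  .inr ((hσ.status_eq_of_mem_parts hC).trans hx)

theorem mem_iff_mem_parts_union (he : e ∈ σ.T) :
    G.compOf (.inl e.1) ∈ G.parts (σ.component x) ∪ G.parts (σ.component y) ↔
      G.compOf (.inr e.2) ∈ G.parts (σ.component x) ∪ G.parts (σ.component y) :=
  or_congr (hσ.compOf_mem_parts_iff he) (hσ.compOf_mem_parts_iff he)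

-- The vertex `b`, at the minimum on the side which the rotation lowers, forces the gain at `b`
-- to vanish, and with it the gain at every ancestor.
theorem rigid_of_descendent (hr : σ.IsForest root) (hb : σ.status (G.compOf b) = .active)
    (hs : s ∈ σ.entrySides (root (G.compOf b))) (hside : sideOf b = s.opp)
    (hΩ : σ.profit b = σ.Ω) (hd : σ.Descendent C (G.compOf b)) :
    G.Rigid σ.profit σ.Ω C := by
  rintro z hz hle q rfl
  refine hσ.eq_of_gain_nonpos hz hle hr hb hs ?_ hd
  rw [gain_of_eq_opp z _ hside]
  exact sub_nonpos.2 (hle.le_of_eq hΩ)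

theorem rigid_of_mem_minSub1 (hx : σ.status (G.compOf x) = .active)
    (hboth : G.MinOnBoth σ.profit (σ.component x)) (hC : C ∈ σ.minSub1 (σ.component x)) :
    G.Rigid σ.profit σ.Ω C := by
  obtain ⟨root, hr⟩ := hσ.exists_forest
  have hrigid {s : Side} {b : U ⊕ V} (hb : b ∈ σ.component x)
      (hs : s ∈ σ.entrySides (root (G.compOf x))) :=
    hσ.rigid_of_descendent (C := C) hr ((hσ.status_eq_of_mem hb).trans hx)
      (hσ.root_eq_of_mem hr hb hx ▸ hs)
  obtain ⟨C₀, hC₀, hC⟩ := hC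
  obtain rfl := hσ.eq_root_of_isRoot hr hx hC₀
  obtain rfl | ⟨B, ⟨hB, -, hmin, s, hs, b, ⟨rfl, -, hside⟩, hbmin⟩, hCB⟩ := hC
  · obtain ⟨s, hs⟩ := (hr.inTree _ hx).entry_nonempty
    have hopp : G.AttainsMin σ.profit s.opp (σ.component x) := by
      cases s
      exacts [hboth.2, hboth.1]
    obtain ⟨b, hb, hside, hΩ⟩ := (hσ.attainsMin_iff hx).1 hopp
    exact hrigid hb hs hside hΩ (hC₀.2 _ (hσ.compOf_mem_parts.2 hb))
  · obtain ⟨r, hrx, hroot, -, hΩ⟩ := hσ.exists_mem_component_of_mem_entrySides hr hx hs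
    have hb := hσ.compOf_mem_parts.1 hB
    refine hrigid hb hs hside (le_antisymm ?_ (hσ.le_profit b (hσ.unsettled_of_mem hx hb))) hCB.2
    rw [hbmin, hmin, ← hΩ]
    exact minShare_le _ hroot (hσ.essentialVertex (hσ.unsettled_of_mem hx hrx))

theorem gain_nonneg_of_hasMinIn (hz : G.IsCore z) (hle : DiffersAbove σ.Ω σ.profit z)
    (hx : σ.status (G.compOf x) = .active) (hs : G.HasMinIn σ.profit s (σ.component x)) :
    0 ≤ gain s z σ.profit x := by
  obtain ⟨root, hr⟩ := hσ.exists_forest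
  exact hσ.gain_nonneg hz hle hr hx ((hσ.mem_entrySides_iff hr hx hs).2 rfl)

theorem rigid_of_mem_rootPath (hx : σ.status (G.compOf x) = .active)
    (hs : G.HasMinIn σ.profit s (σ.component x))
    (hgain : ∀ z, G.IsCore z → DiffersAbove σ.Ω σ.profit z → gain s z σ.profit x ≤ 0)
    (hC : C ∈ σ.rootPath (σ.component x) (G.compOf x)) : G.Rigid σ.profit σ.Ω C := by
  rintro z hz hle q rfl
  obtain ⟨root, hr⟩ := hσ.exists_forest
  obtain ⟨-, -, -, hd⟩ := hC
  exact hσ.eq_of_gain_nonpos hz hle hr hx ((hσ.mem_entrySides_iff hr hx hs).2 rfl)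
    (hgain z hz hle) hd

theorem repair (hx : σ.status (G.compOf x) = .active)
    (hboth : G.MinOnBoth σ.profit (σ.component x)) :
    σ.Improves
      (σ.settle σ.T (G.parts (σ.component x)) (σ.minSub1 (σ.component x)) .repaired) := by
  have h : σ.CanSettle σ.T (G.parts (σ.component x)) (σ.minSub1 (σ.component x)) :=
    { subset_T := subset_rfl
      new_edge := fun _ he he' => absurd he he'
      subset := hσ.minSub1_subset hx
      mem_iff_mem := fun _ => hσ.compOf_mem_parts_iff
      mem_of_settled := fun _ hC hu => absurd (hσ.unsettled_of_mem_parts hx hC) hu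
      rigid := fun _ hC _ => hσ.rigid_of_mem_minSub1 hx hboth hC }
  obtain ⟨root, hr⟩ := hσ.exists_forest
  exact h.improves (by simp [Status.Unsettled]) hσ ⟨_, hσ.isRoot_root hr hx, .inl rfl⟩
    (.inr (hr.inTree _ hx).root_active)

end Valid

namespace Legitimate

variable {z : U ⊕ V → ℝ} {M : Set G.Comp} (he : σ.Legitimate e x y)
include he

theorem gain_le_gain (hz : G.IsCore z) :
    gain (sideOf y) z σ.profit x ≤ gain (sideOf y) z σ.profit y :=
  gain_le_gain_of_joins hz he.1.1 he.2.2.1 he.joins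

omit [Fintype U] [Fintype V] in
theorem new_edge (hx : G.compOf x ∈ M) (hy : G.compOf y ∈ M) {f : U × V}
    (hf : f ∈ insert e σ.T) (hf' : f ∉ σ.T) :
    f ∈ G.edges ∧ σ.profit (.inl f.1) + σ.profit (.inr f.2) = G.weight f ∧
      G.compOf (.inl f.1) ∈ M ∧ G.compOf (.inr f.2) ∈ M := by
  obtain rfl := hf.resolve_right hf'
  refine ⟨he.1.1, he.2.2.1, ?_⟩
  obtain ⟨rfl, rfl⟩ | ⟨rfl, rfl⟩ := he.joins
  exacts [⟨hx, hy⟩, ⟨hy, hx⟩]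

end Legitimate

namespace Valid

variable {st : Status} (hσ : σ.Valid) (he : σ.Legitimate e x y)
include hσ he

theorem meet (hy : σ.status (G.compOf y) = .active)
    (hmin : G.HasMinIn σ.profit (sideOf y).opp (σ.component y)) :
    σ.Improves (σ.settle (insert e σ.T) (G.parts (σ.component x) ∪ G.parts (σ.component y))
      (σ.minSub2 x y) .repaired) := by
  have hx := he.active
  have hgain (z : U ⊕ V → ℝ) (hz : G.IsCore z) (hle : DiffersAbove σ.Ω σ.profit z) :
      0 ≤ -gain (sideOf y) z σ.profit y :=
    (hσ.gain_nonneg_of_hasMinIn hz hle hy hmin).trans_eq (gain_opp _ _ _ _)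
  have h : σ.CanSettle (insert e σ.T) (G.parts (σ.component x) ∪ G.parts (σ.component y))
      (σ.minSub2 x y) :=
    { subset_T := Set.subset_insert _ _
      new_edge := fun _ =>
        he.new_edge (.inl (hσ.compOf_mem_rootPath hx)) (.inr (hσ.compOf_mem_rootPath hy))
      subset := Set.union_subset_union (hσ.rootPath_subset hx) (hσ.rootPath_subset hy)
      mem_iff_mem := fun _ => hσ.mem_iff_mem_parts_union
      mem_of_settled := fun C hC hu =>
        absurd (hC.elim (hσ.unsettled_of_mem_parts hx) (hσ.unsettled_of_mem_parts hy)) hu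
      rigid := fun C hC _ => hC.elim
        (hσ.rigid_of_mem_rootPath hx he.hasMinIn fun z hz hle =>
          (he.gain_le_gain hz).trans (neg_nonneg.1 (hgain z hz hle)))
        (hσ.rigid_of_mem_rootPath hy hmin fun z hz hle => by
          rw [gain_opp]
          exact neg_nonpos.2 ((hσ.gain_nonneg_of_hasMinIn hz hle hx he.hasMinIn).trans
            (he.gain_le_gain hz))) }
  exact h.improves (by simp [Status.Unsettled]) hσ (.inl (hσ.compOf_mem_rootPath hx)) (.inr hx)

theorem attach (hy : ¬ (σ.status (G.compOf y)).Unsettled) (hst : ¬ st.Unsettled) :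
    σ.Improves (σ.settle (insert e σ.T) (G.parts (σ.component x) ∪ G.parts (σ.component y))
      (σ.minSub3 x y) st) := by
  have hx := he.active
  have hgain (z : U ⊕ V → ℝ) (hz : G.IsCore z) (hle : DiffersAbove σ.Ω σ.profit z) :
      gain (sideOf y) z σ.profit x ≤ 0 := by
    obtain ⟨θ, hθ, -, hrigid⟩ := hσ.rigid _ hy
    exact (he.gain_le_gain hz).trans_eq
      (gain_eq_zero_iff.2 (hrigid z hz (hle.mono hθ) y rfl))
  have h : σ.CanSettle (insert e σ.T) (G.parts (σ.component x) ∪ G.parts (σ.component y))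
      (σ.minSub3 x y) :=
    { subset_T := Set.subset_insert _ _
      new_edge := fun _ => he.new_edge (.inl (hσ.compOf_mem_rootPath hx))
        (.inr (hσ.compOf_mem_parts.2 (σ.mem_component_self y)))
      subset := Set.union_subset_union (hσ.rootPath_subset hx) subset_rfl
      mem_iff_mem := fun _ => hσ.mem_iff_mem_parts_union
      mem_of_settled := fun C hC hu =>
        .inr (hC.resolve_left fun hC => hu (hσ.unsettled_of_mem_parts hx hC))
      rigid := fun C hC hu => hC.elim (hσ.rigid_of_mem_rootPath hx he.hasMinIn hgain)
        fun hC => absurd (hσ.status_eq_of_mem_parts hC ▸ hu) hy }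
  exact h.improves hst hσ (.inl (hσ.compOf_mem_rootPath hx)) (.inr hx)

omit he in
theorem event (h : Event σ σ') : σ.Improves σ' := by
  cases h with
  | activate C hC hmin =>
    suffices hmoves : σ.MovesToActive _ C from hmoves.improves
      (hσ.activate hC hmin hmoves (by simp) (by simp) rfl)
    exact
      { profit_eq := rfl
        Ω_eq := rfl
        bin := hC
        status_self := by simp
        status_of_ne := fun _ hD => by simp [hD]
        parent_of_ne := fun _ hD => by simp [hD]
        entrySides_of_ne := fun _ hD => by simp [hD]
        subset_T := subset_rfl
        new_edge := fun _ he he' => absurd he he' }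
  | repair x hx hboth => exact hσ.repair hx hboth
  | grow e x y he hy =>
    suffices hmoves : σ.MovesToActive _ (G.compOf y) from
      hmoves.improves (hσ.grow he hmoves (by simp) rfl)
    exact
      { profit_eq := rfl
        Ω_eq := rfl
        bin := hy
        status_self := by simp
        status_of_ne := fun _ hD => by simp [hD]
        parent_of_ne := fun _ hD => by simp [hD]
        entrySides_of_ne := fun _ _ => rfl
        subset_T := Set.subset_insert ..
        new_edge := fun f hf hf' => by
          obtain rfl := hf.resolve_right hf'
          exact ⟨he.1.1, he.2.2.1, x, y, he.joins, he.active, rfl⟩ }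
  | meet e x y he hy hopp =>
    obtain ⟨s, hs, hs'⟩ := hopp
    exact hσ.meet he hy (he.hasMinIn.eq_of_attainsMin hs.2 ▸ hs')
  | freeze e x y he hy =>
    exact hσ.attach he (by simp [Status.Unsettled, hy]) (by simp [Status.Unsettled])
  | attach e x y he hy =>
    exact hσ.attach he (by simp [Status.Unsettled, hy]) (by simp [Status.Unsettled])

end Valid
end State

namespace State

/-! ### Raising `Ω` -/

variable {U V : Type*} {G : AssignmentGame U V} {σ τ : State G} {e : U × V} {q x y : U ⊕ V}
  {i : (U ⊕ V) ⊕ (U × V)} {s : Side} {t δ : ℝ}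

theorem rate_eq_zero (h : σ.status (G.compOf q) ≠ .active) : σ.rate q = 0 := by
  rw [rate, if_neg fun h' => h h'.1]

theorem rate_eq_zero_of_not_essentialVertex (h : ¬ G.EssentialVertex q) : σ.rate q = 0 := by
  rw [rate, if_neg fun h' => h h'.2]

theorem rate_eq_zero_of_minOnBoth (h : G.MinOnBoth σ.profit (σ.component q)) : σ.rate q = 0 := by
  rw [rate, if_neg fun h' : G.HasMinIn _ _ _ => h'.1 h,
    if_neg fun h' : G.HasMinIn _ _ _ => h'.1 h, ite_self]

theorem rate_nonpos_of_lt_one (h : σ.rate q < 1) : σ.rate q ≤ 0 := by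
  revert h; unfold rate; split_ifs <;> norm_num

theorem rate_eq_neg_one_of_neg (h : σ.rate q < 0) : σ.rate q = -1 := by
  revert h; unfold rate; split_ifs <;> norm_num

theorem advance_zero (σ : State G) : σ.advance 0 = σ := by
  simp [State.advance]

theorem advance_profit (σ : State G) (t : ℝ) (q : U ⊕ V) :
    (σ.advance t).profit q = σ.profit q + t * σ.rate q := rfl

theorem advance_profit_of_settled (h : ¬ (σ.status (G.compOf q)).Unsettled) :
    (σ.advance t).profit q = σ.profit q := by
  rw [advance_profit, rate_eq_zero fun h' => h (.inr h'), mul_zero, add_zero]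

theorem NextEventAfter.not_eventDue (h : σ.NextEventAfter δ) : ¬ σ.EventDue := by
  simpa only [advance_zero] using h.2.2.2 0 le_rfl h.2.1

/-- The inequalities demanded by the invariant: a vertex stands for `Ω ≤ profit q`, as long as its
component is not settled, and an edge for `weight e ≤ profit i + profit j`. -/
def IsConstraint (σ : State G) : (U ⊕ V) ⊕ (U × V) → Prop
  | .inl q => (σ.status (G.compOf q)).Unsettled
  | .inr e => e ∈ G.edges

/-- The difference of the two sides of the inequality that `i` stands for in `IsConstraint`. -/
def slack (σ : State G) : (U ⊕ V) ⊕ (U × V) → ℝ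
  | .inl q => σ.profit q - σ.Ω
  | .inr e => σ.profit (.inl e.1) + σ.profit (.inr e.2) - G.weight e

/-- The rate at which `slack` changes while `Ω` is raised. -/
noncomputable def slackRate (σ : State G) : (U ⊕ V) ⊕ (U × V) → ℝ
  | .inl q => σ.rate q - 1
  | .inr e => σ.rate (.inl e.1) + σ.rate (.inr e.2)

/-- No inequality whose slack decreases at `σ` is an equality at `τ`. It is applied to
`τ = σ.advance t`, where it characterizes the times at which no event is due. -/
def Uncritical (σ τ : State G) : Prop :=
  ∀ i, σ.IsConstraint i → σ.slackRate i < 0 → 0 < τ.slack i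

theorem slack_advance (σ : State G) (t : ℝ) (i : (U ⊕ V) ⊕ (U × V)) :
    (σ.advance t).slack i = σ.slack i + t * σ.slackRate i := by
  cases i <;> simp only [slack, slackRate, advance] <;> ring

theorem Uncritical.lt_profit (h : σ.Uncritical τ) (hq : (σ.status (G.compOf q)).Unsettled)
    (hr : σ.rate q < 1) : τ.Ω < τ.profit q :=
  sub_pos.1 (h (.inl q) hq (sub_neg.2 hr))

theorem Uncritical.weight_lt (h : σ.Uncritical τ) (he : e ∈ G.edges)
    (hr : σ.rate (.inl e.1) + σ.rate (.inr e.2) < 0) :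
    G.weight e < τ.profit (.inl e.1) + τ.profit (.inr e.2) :=
  sub_pos.1 (h (.inr e) he hr)

theorem exists_joins_rate_eq_neg_one (h : σ.rate (.inl e.1) + σ.rate (.inr e.2) < 0) :
    ∃ x y, Joins e x y ∧ σ.rate x = -1 ∧ σ.rate y ≤ 0 := by
  obtain hl | hl := lt_or_ge (σ.rate (.inl e.1)) 0
  · have hl := rate_eq_neg_one_of_neg hl
    exact ⟨_, _, joins_self e, hl, rate_nonpos_of_lt_one (by linarith)⟩
  · have hr := rate_eq_neg_one_of_neg (show σ.rate (.inr e.2) < 0 by linarith)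
    exact ⟨_, _, (joins_self e).symm, hr, rate_nonpos_of_lt_one (by linarith)⟩

theorem exists_first_zero {ι : Type*} [Finite ι] {S : Set ι} {a b : ι → ℝ}
    (ha : ∀ i ∈ S, 0 ≤ a i) (hab : ∀ i ∈ S, b i < 0 → 0 < a i) (hb : ∃ i ∈ S, b i < 0) :
    ∃ δ > 0, (∀ t, 0 ≤ t → t ≤ δ → ∀ i ∈ S, 0 ≤ a i + t * b i) ∧
      (∀ t < δ, ∀ i ∈ S, b i < 0 → 0 < a i + t * b i) ∧
      ∃ i ∈ S, b i < 0 ∧ a i + δ * b i = 0 := by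
  obtain ⟨i, ⟨hi, hbi⟩, hmin⟩ := Set.exists_min_image {i | i ∈ S ∧ b i < 0}
    (fun i => a i / -b i) (Set.toFinite _) hb
  have hpos {j : ι} (hj : b j < 0) : 0 < -b j := neg_pos.2 hj
  refine ⟨a i / -b i, div_pos (hab i hi hbi) (hpos hbi), fun t ht htδ j hj => ?_,
    fun t ht j hj hbj => ?_, i, hi, hbi, ?_⟩
  · obtain hbj | hbj := lt_or_ge (b j) 0
    · have := (le_div_iff₀ (hpos hbj)).1 (htδ.trans (hmin j ⟨hj, hbj⟩))
      linarith
    · exact add_nonneg (ha j hj) (mul_nonneg ht hbj)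
  · have := (lt_div_iff₀ (hpos hbj)).1 (ht.trans_le (hmin j ⟨hj, hbj⟩))
    linarith
  · rw [div_neg, neg_mul, div_mul_cancel₀ _ hbi.ne, add_neg_cancel]

variable [Fintype U] [Fintype V]

theorem rigid_advance {θ : ℝ} {C : G.Comp} (hC : ¬ (σ.status C).Unsettled) (ht : 0 ≤ t)
    (hslack : ∀ i, σ.IsConstraint i → 0 ≤ (σ.advance t).slack i) (hθ : θ ≤ σ.Ω)
    (h : G.Rigid σ.profit θ C) : G.Rigid (σ.advance t).profit θ C := by
  rintro z hz hle q rfl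
  rw [advance_profit_of_settled hC]
  refine h z hz (fun r => ?_) q rfl
  by_cases hr : (σ.status (G.compOf r)).Unsettled
  · refine .inl ((hle r).elim id fun heq => heq ▸ hθ.trans ?_)
    exact (le_add_of_nonneg_right ht).trans (sub_nonneg.1 (hslack (.inl r) hr))
  · exact advance_profit_of_settled (t := t) hr ▸ hle r

namespace Valid

variable (hσ : σ.Valid)
include hσ

theorem slack_nonneg (hi : σ.IsConstraint i) : 0 ≤ σ.slack i := by
  obtain q | e := i
  exacts [sub_nonneg.2 (hσ.le_profit q hi), sub_nonneg.2 (hσ.core.isCover.weight_le e hi)]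

theorem rate_eq_one (hx : σ.status (G.compOf x) = .active) (hq : q ∈ σ.component x)
    (hs : G.HasMinIn σ.profit s (σ.component x)) (h : sideOf q = s) : σ.rate q = 1 := by
  have hqa := (hσ.status_eq_of_mem hq).trans hx
  rw [rate, if_pos ⟨hqa, hσ.essentialVertex (.inr hqa)⟩, component_eq hq, if_pos (h ▸ hs)]

theorem rate_eq_neg_one (hx : σ.status (G.compOf x) = .active) (hq : q ∈ σ.component x)
    (hs : G.HasMinIn σ.profit s (σ.component x)) (h : sideOf q = s.opp) : σ.rate q = -1 := by
  have hqa := (hσ.status_eq_of_mem hq).trans hx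
  rw [rate, if_pos ⟨hqa, hσ.essentialVertex (.inr hqa)⟩, component_eq hq, h, if_neg fun h' =>
    s.ne_opp.symm (hs.eq_of_attainsMin h'.2), s.opp_opp, if_pos hs]

theorem rate_add_rate_eq_zero (he : e ∈ σ.T) : σ.rate (.inl e.1) + σ.rate (.inr e.2) = 0 := by
  have hl := σ.mem_component_self (.inl e.1)
  have hr : Sum.inr e.2 ∈ σ.component (.inl e.1) := mem_component_of_joins (joins_self e) he
  by_cases ha : σ.status (G.compOf (.inl e.1)) = .active
  · by_cases hb : G.MinOnBoth σ.profit (σ.component (.inl e.1))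
    · rw [rate_eq_zero_of_minOnBoth hb, rate_eq_zero_of_minOnBoth (by rwa [component_eq hr]),
        add_zero]
    · obtain ⟨s, hs⟩ := hσ.exists_hasMinIn ha hb
      cases s
      · rw [hσ.rate_eq_one ha hl hs rfl, hσ.rate_eq_neg_one ha hr hs rfl, add_neg_cancel]
      · rw [hσ.rate_eq_neg_one ha hl hs rfl, hσ.rate_eq_one ha hr hs rfl, neg_add_cancel]
  · rw [rate_eq_zero ha, rate_eq_zero (by rwa [← hσ.status_eq e he]), add_zero]

theorem minOnBoth_of_rate_lt_one (hq : σ.status (G.compOf q) = .active) (hr : σ.rate q < 1)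
    (hΩ : σ.profit q = σ.Ω) : G.MinOnBoth σ.profit (σ.component q) := by
  by_contra hboth
  obtain ⟨s, hs⟩ := hσ.exists_hasMinIn hq hboth
  have hside : sideOf q = s := hs.eq_of_attainsMin
    ((hσ.attainsMin_iff hq).2 ⟨q, σ.mem_component_self q, rfl, hΩ⟩)
  exact hr.ne (hσ.rate_eq_one hq (σ.mem_component_self q) hs hside)

theorem eventDue_of_profit_eq (hq : (σ.status (G.compOf q)).Unsettled) (hr : σ.rate q < 1)
    (hΩ : σ.profit q = σ.Ω) : σ.EventDue := by
  obtain hbin | hactive := hq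
  · have hmin : G.minShare σ.profit (G.compOf q).supp = σ.Ω :=
      minShare_eq (fun r (hr : G.compOf r = _) _ => hσ.le_profit r (hr ▸ .inl hbin))
        (show q ∈ (G.compOf q).supp from rfl) (hσ.essentialVertex (.inl hbin)) hΩ
    exact ⟨_, .activate _ hbin hmin⟩
  · exact ⟨_, .repair q hactive (hσ.minOnBoth_of_rate_lt_one hactive hr hΩ)⟩

theorem legitimate_of_tight (he : e ∈ G.edges) (hxy : Joins e x y)
    (ht : σ.profit (.inl e.1) + σ.profit (.inr e.2) = G.weight e)
    (hx : σ.rate x = -1) (hy : σ.rate y ≤ 0) : σ.Legitimate e x y := by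
  have hactive : σ.status (G.compOf x) = .active := by
    by_contra h
    linarith [rate_eq_zero h]
  have hboth : ¬ G.MinOnBoth σ.profit (σ.component x) := fun h => by
    linarith [rate_eq_zero_of_minOnBoth h]
  have hxm := σ.mem_component_self x
  obtain ⟨s, hs⟩ := hσ.exists_hasMinIn hactive hboth
  have hxs : sideOf x = s.opp := (s.eq_or_eq_opp (sideOf x)).resolve_left fun h => by
    linarith [hσ.rate_eq_one hactive hxm hs h]
  have hys : sideOf y = s := by rw [hxy.sideOf_eq, hxs, s.opp_opp]
  have hyx : y ∉ σ.component x := fun h => by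
    linarith [hσ.rate_eq_one hactive h hs hys]
  have hsubpar := subparEdge_of_notMem_startEdges he fun h =>
    hyx (mem_component_of_joins hxy (hσ.start_subset h))
  exact ⟨hsubpar, hxy, ht, hactive, hyx, s, hs, hxm, hσ.essentialVertex (.inr hactive), hxs⟩

theorem eventDue_of_legitimate (he : σ.Legitimate e x y) (hy : σ.rate y ≤ 0) : σ.EventDue := by
  cases hst : σ.status (G.compOf y) with
  | frozen => exact ⟨_, .freeze e x y he hst⟩
  | bin => exact ⟨_, .grow e x y he hst⟩
  | repaired => exact ⟨_, .attach e x y he hst⟩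
  | active =>
    by_cases hboth : G.MinOnBoth σ.profit (σ.component y)
    · exact ⟨_, .repair y hst hboth⟩
    · obtain ⟨s, hs⟩ := hσ.exists_hasMinIn hst hboth
      obtain h | rfl := (sideOf y).eq_or_eq_opp s
      · linarith [hσ.rate_eq_one hst (σ.mem_component_self y) hs h.symm]
      · exact ⟨_, .meet e x y he hst ⟨_, he.hasMinIn, hs⟩⟩

theorem uncritical_of_not_eventDue (h : ¬ σ.EventDue) : σ.Uncritical σ := by
  refine fun i hi hr => (hσ.slack_nonneg hi).lt_of_ne fun h0 => h ?_
  obtain q | e := i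
  · exact hσ.eventDue_of_profit_eq hi (sub_neg.1 hr) (sub_eq_zero.1 h0.symm)
  · obtain ⟨x, y, hxy, hx, hy⟩ := exists_joins_rate_eq_neg_one hr
    exact hσ.eventDue_of_legitimate
      (hσ.legitimate_of_tight hi hxy (sub_eq_zero.1 h0.symm) hx hy) hy

theorem not_minOnBoth (h : σ.Uncritical σ) (hx : σ.status (G.compOf x) = .active) :
    ¬ G.MinOnBoth σ.profit (σ.component x) := fun hboth => by
  obtain ⟨q, hq, -, hΩ⟩ := (hσ.attainsMin_iff hx).1 hboth.1
  have hrate : σ.rate q = 0 := rate_eq_zero_of_minOnBoth (by rwa [component_eq hq])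
  exact (h.lt_profit (hσ.unsettled_of_mem hx hq) (by linarith)).ne' hΩ

theorem rate_pos_of_legitimate (h : σ.Uncritical σ) (he : σ.Legitimate e x y) :
    0 < σ.rate y := by
  have hx : σ.rate x = -1 :=
    hσ.rate_eq_neg_one he.active (σ.mem_component_self x) he.hasMinIn he.joins.symm.sideOf_eq
  by_contra! hy
  refine (h.weight_lt he.1.1 ?_).ne' he.2.2.1
  linarith [he.joins.add_eq σ.rate]

theorem not_eventDue (h : σ.Uncritical σ) : ¬ σ.EventDue := by
  have hne {e : U × V} {x y : U ⊕ V} (he : σ.Legitimate e x y) :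
      ¬ σ.status (G.compOf y) ≠ .active :=
    fun hy => (hσ.rate_pos_of_legitimate h he).ne' (rate_eq_zero hy)
  rintro ⟨σ', hσ'⟩
  cases hσ' with
  | activate C hC hmin =>
    obtain ⟨q, rfl⟩ := exists_compOf_eq C
    obtain ⟨r, hrq : G.compOf r = G.compOf q, -, hrmin⟩ := exists_eq_minShare σ.profit
      (show q ∈ (G.compOf q).supp from rfl) (hσ.essentialVertex (.inl hC))
    have hr : σ.status (G.compOf r) = .bin := hrq ▸ hC
    have hrate : σ.rate r = 0 := rate_eq_zero (by simp [hr])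
    exact (h.lt_profit (.inl hr) (by linarith)).ne' (hrmin.trans hmin)
  | repair x hx hboth => exact hσ.not_minOnBoth h hx hboth
  | grow e x y he hy => exact hne he (by simp [hy])
  | freeze e x y he hy => exact hne he (by simp [hy])
  | attach e x y he hy => exact hne he (by simp [hy])
  | meet e x y he hy hopp =>
    obtain ⟨s, hs, hs'⟩ := hopp
    obtain rfl := he.hasMinIn.eq_of_attainsMin hs.2
    have hrate := hσ.rate_eq_neg_one hy (σ.mem_component_self y) hs' (Side.opp_opp _).symm
    linarith [hσ.rate_pos_of_legitimate h he]

theorem advance_isCore (ht : 0 ≤ t)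
    (hslack : ∀ i, σ.IsConstraint i → 0 ≤ (σ.advance t).slack i) :
    G.IsCore (σ.advance t).profit := by
  refine IsCover.isCore_of_tight ⟨fun q => ?_, fun e he => sub_nonneg.1 (hslack (.inr e) he)⟩
    (fun e he => ?_) fun q hq => ?_
  · by_cases hq : (σ.status (G.compOf q)).Unsettled
    · exact (add_nonneg hσ.nonneg ht).trans (sub_nonneg.1 (hslack (.inl q) hq))
    · exact (hσ.core.isCover.nonneg q).trans_eq (advance_profit_of_settled hq).symm
  · have he := hσ.start_subset he
    rw [advance_profit, advance_profit]
    linear_combination hσ.tight e he + t * hσ.rate_add_rate_eq_zero he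
  · rw [advance_profit, rate_eq_zero_of_not_essentialVertex hq, hσ.core.eq_zero hq, mul_zero,
      add_zero]

theorem advance_inTree {root : G.Comp → G.Comp} (hr : σ.IsForest root)
    (hu : σ.Uncritical σ) (hx : σ.status (G.compOf x) = .active) (t : ℝ) :
    (σ.advance t).InTree (root (G.compOf x)) (G.compOf x) := by
  obtain ⟨s', hs'⟩ := hσ.exists_hasMinIn hx (hσ.not_minOnBoth hu hx)
  have htree := hr.inTree _ hx
  refine { htree with entry_attained := fun s hs => ?_ }
  obtain ⟨r, hrx, hroot, hside, hΩ⟩ := hσ.exists_mem_component_of_mem_entrySides hr hx hs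
  obtain rfl := (hσ.mem_entrySides_iff hr hx hs').1 hs
  refine ⟨r, hroot, hside, ?_⟩
  rw [advance_profit, hσ.rate_eq_one hx hrx hs' hside, hΩ, mul_one]
  rfl

theorem advance (hu : σ.Uncritical σ) (ht : 0 ≤ t)
    (hslack : ∀ i, σ.IsConstraint i → 0 ≤ (σ.advance t).slack i) : (σ.advance t).Valid where
  core := hσ.advance_isCore ht hslack
  nonneg := add_nonneg hσ.nonneg ht
  start_subset := hσ.start_subset
  mem_edges := hσ.mem_edges
  tight e he := by
    rw [advance_profit, advance_profit]
    linear_combination hσ.tight e he + t * hσ.rate_add_rate_eq_zero he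
  status_eq := hσ.status_eq
  ne_bin := hσ.ne_bin
  fundamental := hσ.fundamental
  le_profit q hq := sub_nonneg.1 (hslack (.inl q) hq)
  exists_forest := by
    obtain ⟨root, hr⟩ := hσ.exists_forest
    refine ⟨root, fun C hC => ?_, hr.root_eq⟩
    obtain ⟨x, rfl⟩ := exists_compOf_eq C
    exact hσ.advance_inTree hr hu hC t
  rigid C hC := by
    obtain ⟨θ, hθ, hle, hrigid⟩ := hσ.rigid C hC
    refine ⟨θ, hθ.trans (le_add_of_nonneg_right ht), fun q hq he => ?_,
      rigid_advance hC ht hslack hθ hrigid⟩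
    exact (hle q hq he).trans_eq (advance_profit_of_settled (hq ▸ hC)).symm

theorem rate_advance (hu : σ.Uncritical σ) (hτ : (σ.advance t).Valid)
    (hboth : ∀ x, σ.status (G.compOf x) = .active →
      ¬ G.MinOnBoth (σ.advance t).profit (σ.component x)) (x : U ⊕ V) :
    (σ.advance t).rate x = σ.rate x := by
  by_cases hx : σ.status (G.compOf x) = .active
  · have hxm := σ.mem_component_self x
    obtain ⟨s, hs⟩ := hσ.exists_hasMinIn hx (hσ.not_minOnBoth hu hx)
    have hτs : G.HasMinIn (σ.advance t).profit s ((σ.advance t).component x) := by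
      refine ⟨hboth x hx, ?_⟩
      obtain ⟨r, hr, hrs, hΩ⟩ := (hσ.attainsMin_iff hx).1 hs.2
      refine (hτ.attainsMin_iff hx).2 ⟨r, hr, hrs, ?_⟩
      rw [advance_profit, hσ.rate_eq_one hx hr hs hrs, hΩ, mul_one]
      rfl
    obtain h | h := s.eq_or_eq_opp (sideOf x)
    · rw [hσ.rate_eq_one hx hxm hs h, hτ.rate_eq_one hx hxm hτs h]
    · rw [hσ.rate_eq_neg_one hx hxm hs h, hτ.rate_eq_neg_one hx hxm hτs h]
  · exact (rate_eq_zero (σ := σ.advance t) hx).trans (rate_eq_zero hx).symm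

theorem not_minOnBoth_advance (hu : σ.Uncritical σ) (hτ : (σ.advance t).Valid)
    (h : σ.Uncritical (σ.advance t)) (hx : σ.status (G.compOf x) = .active) :
    ¬ G.MinOnBoth (σ.advance t).profit (σ.component x) := fun hboth => by
  obtain ⟨s, hs⟩ := hσ.exists_hasMinIn hx (hσ.not_minOnBoth hu hx)
  have hopp : G.AttainsMin (σ.advance t).profit s.opp ((σ.advance t).component x) := by
    cases s
    exacts [hboth.2, hboth.1]
  obtain ⟨r, hr, hrs, hΩ⟩ := (hτ.attainsMin_iff hx).1 hopp
  have hrate := hσ.rate_eq_neg_one hx hr hs hrs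
  exact (h.lt_profit (hσ.unsettled_of_mem hx hr) (by linarith)).ne' hΩ

theorem not_eventDue_advance_iff (hu : σ.Uncritical σ) (hτ : (σ.advance t).Valid) :
    ¬ (σ.advance t).EventDue ↔ σ.Uncritical (σ.advance t) := by
  have hrate_eq (h : (σ.advance t).rate = σ.rate) :
      (σ.advance t).slackRate = σ.slackRate := by
    funext i
    cases i <;> simp only [slackRate, h]
  constructor <;> intro h
  · have hτu := hτ.uncritical_of_not_eventDue h
    have hrate := hrate_eq (funext (hσ.rate_advance hu hτ fun x hx => hτ.not_minOnBoth hτu hx))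
    exact fun i hi hneg => hτu i hi (by rwa [hrate])
  · have hrate := hrate_eq
      (funext (hσ.rate_advance hu hτ fun x => hσ.not_minOnBoth_advance hu hτ h))
    exact hτ.not_eventDue fun i hi hneg => h i hi (by rwa [← hrate])

theorem exists_rate_lt_one (hu : σ.Uncritical σ) (hh : ¬ σ.Halted) :
    ∃ q, (σ.status (G.compOf q)).Unsettled ∧ σ.rate q < 1 := by
  simp only [Halted, not_forall] at hh
  obtain ⟨C, hC⟩ := hh
  obtain ⟨q, rfl⟩ := exists_compOf_eq C
  by_cases hbin : σ.status (G.compOf q) = .bin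
  · exact ⟨q, .inl hbin, by rw [rate_eq_zero (by simp [hbin])]; norm_num⟩
  · have hactive : σ.status (G.compOf q) = .active := by_contra fun h => hC ⟨hbin, h⟩
    obtain ⟨s, hs⟩ := hσ.exists_hasMinIn hactive (hσ.not_minOnBoth hu hactive)
    obtain ⟨r, hr, hrs⟩ := (hσ.essentialVertex (.inr hactive)).exists_sideOf_eq s.opp
    refine ⟨r, .inr (hr ▸ hactive), ?_⟩
    rw [hσ.rate_eq_neg_one hactive (hσ.mem_component_of_compOf_eq hr) hs hrs]
    norm_num

theorem exists_nextEventAfter (hd : ¬ σ.EventDue) (hh : ¬ σ.Halted) :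
    ∃ δ, σ.NextEventAfter δ ∧ ∀ t, 0 ≤ t → t ≤ δ → (σ.advance t).Valid := by
  have hu := hσ.uncritical_of_not_eventDue hd
  obtain ⟨q, hq, hrate⟩ := hσ.exists_rate_lt_one hu hh
  obtain ⟨δ, hδ, hslack, hpos, i, hi, hneg, hzero⟩ :=
    exists_first_zero (S := {i | σ.IsConstraint i}) (fun _ => hσ.slack_nonneg) hu
      ⟨.inl q, hq, sub_neg.2 hrate⟩
  simp only [← slack_advance] at hslack hpos hzero
  have hvalid (t : ℝ) (ht : 0 ≤ t) (htδ : t ≤ δ) : (σ.advance t).Valid :=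
    hσ.advance hu ht (hslack t ht htδ)
  refine ⟨δ, ⟨hh, hδ, ?_, fun t ht htδ => ?_⟩, hvalid⟩
  · by_contra h
    exact ((hσ.not_eventDue_advance_iff hu (hvalid δ hδ.le le_rfl)).1 h i hi hneg).ne' hzero
  · exact (hσ.not_eventDue_advance_iff hu (hvalid t ht htδ.le)).2 (hpos t htδ)

theorem advance_of_nextEventAfter (h : σ.NextEventAfter δ) (ht : 0 ≤ t) (htδ : t ≤ δ) :
    (σ.advance t).Valid := by
  obtain ⟨δ', h', hvalid⟩ := hσ.exists_nextEventAfter h.not_eventDue h.1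
  refine hvalid t ht (htδ.trans ?_)
  by_contra! hlt
  exact h.2.2.2 δ' h'.2.1.le hlt h'.2.2.1

theorem halted_or_exists_step : σ.Halted ∨ ∃ σ', Step σ σ' := by
  by_cases hd : σ.EventDue
  · obtain ⟨σ', h⟩ := hd
    exact .inr ⟨σ', .event σ' h⟩
  · refine or_iff_not_imp_left.2 fun hh => ?_
    obtain ⟨δ, h, -⟩ := hσ.exists_nextEventAfter hd hh
    exact ⟨_, .raise δ h⟩

theorem step (h : Step σ τ) : τ.Valid := by
  cases h with
  | event _ h => exact (hσ.event h).valid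
  | raise δ h => exact hσ.advance_of_nextEventAfter h h.2.1.le le_rfl

theorem reaches (h : σ.Reaches τ) : τ.Valid := by
  induction h with
  | refl => exact hσ
  | tail _ h ih => exact ih.step h

end Valid
end State

/-! ### The leximin order -/

section SortedProfits

theorem lex_of_count_lt {α : Type*} [LinearOrder α] {m : α} :
    ∀ {l₁ l₂ : List α}, l₁.Pairwise (· ≤ ·) → l₂.Pairwise (· ≤ ·) → l₁.length = l₂.length →
      l₂.count m < l₁.count m → (∀ b < m, l₁.count b = l₂.count b) → List.Lex (· < ·) l₁ l₂
  | [], _, _, _, _, hm, _ => by simp at hm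
  | _ :: _, [], _, _, hlen, _, _ => by simp at hlen
  | a :: l₁, b :: l₂, h₁, h₂, hlen, hm, hlt => by
    obtain hab | rfl | hba := lt_trichotomy a b
    · exact .rel hab
    · refine .cons (lex_of_count_lt (m := m) h₁.of_cons h₂.of_cons (by simpa using hlen) ?_
        fun c hc => ?_)
      · simpa [List.count_cons] using hm
      · simpa [List.count_cons] using hlt c hc
    · have hcount (c : α) (hc : c ≤ b) : (a :: l₁).count c = 0 := by
        refine List.count_eq_zero.2 fun hmem => ?_
        have hac : a ≤ c := (List.mem_cons.1 hmem).elim Eq.ge (List.rel_of_pairwise_cons h₁)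
        exact (hba.trans_le hac).not_ge hc
      obtain hbm | hbm := lt_or_ge b m
      · simpa [hcount b le_rfl] using hlt b hbm
      · simp [hcount m hbm] at hm

variable {U V : Type*} [Fintype U] [Fintype V] {G : AssignmentGame U V} {p z : U ⊕ V → ℝ}
  {q r : U ⊕ V}

theorem mem_essentialVertices : q ∈ G.essentialVertices ↔ G.EssentialVertex q := by
  simp [essentialVertices]

theorem pairwise_sortedProfits (p : U ⊕ V → ℝ) : (G.sortedProfits p).Pairwise (· ≤ ·) :=
  Multiset.pairwise_sort _ _

theorem length_sortedProfits (p : U ⊕ V → ℝ) :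
    (G.sortedProfits p).length = G.essentialVertices.card := by
  simp [sortedProfits]

open Classical in
theorem count_sortedProfits (p : U ⊕ V → ℝ) (b : ℝ) :
    (G.sortedProfits p).count b = (G.essentialVertices.filter fun q => b = p q).card := by
  rw [← Multiset.coe_count, sortedProfits, Multiset.sort_eq, Multiset.count_map]
  rfl

theorem lex_sortedProfits (hr : G.EssentialVertex r) (hne : z r ≠ p r)
    (hz : ∀ q, z q ≠ p q → z r ≤ z q) (hp : ∀ q, z q ≠ p q → z r < p q) :
    List.Lex (· < ·) (G.sortedProfits z) (G.sortedProfits p) := by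
  classical
  refine lex_of_count_lt (m := z r) (pairwise_sortedProfits z) (pairwise_sortedProfits p)
    (by rw [length_sortedProfits, length_sortedProfits]) ?_ fun b hb => ?_
  · simp only [count_sortedProfits]
    refine Finset.card_lt_card ((Finset.ssubset_iff_of_subset fun q hq => ?_).2
      ⟨r, by simpa [mem_essentialVertices] using hr, by simp [hne]⟩)
    obtain ⟨hq, hrq⟩ := Finset.mem_filter.1 hq
    have hzp : z q = p q := by_contra fun h => (hp q h).ne hrq
    exact Finset.mem_filter.2 ⟨hq, hrq.trans hzp.symm⟩
  · simp only [count_sortedProfits]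
    refine congrArg _ (Finset.filter_congr fun q _ => ?_)
    by_cases h : z q = p q
    · rw [h]
    · exact iff_of_false (hb.trans_le (hz q h)).ne (hb.trans (hp q h)).ne

omit [Fintype U] [Fintype V] in
theorem exists_essentialVertex [Finite U] [Finite V] (hE : G.edges.Nonempty) :
    ∃ q, G.EssentialVertex q := by
  cases nonempty_fintype U
  cases nonempty_fintype V
  obtain ⟨p, hp⟩ := G.exists_isCore
  obtain ⟨e, he⟩ := hE
  by_contra! h
  have hw := hp.isCover.weight_le e he
  rw [hp.eq_zero (h _), hp.eq_zero (h _), add_zero] at hw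
  exact (G.weight_pos e he).not_ge hw

theorem exists_share_eq (p : U ⊕ V → ℝ) (hq : G.EssentialVertex q) : ∃ l, G.share p l = p q := by
  classical
  have hmem : p q ∈ G.shareSet p := Finset.mem_image_of_mem p (mem_essentialVertices.2 hq)
  rwa [← Finset.mem_coe, ← Finset.range_orderEmbOfFin (G.shareSet p) rfl] at hmem

theorem exists_last_share (p : U ⊕ V → ℝ) (hq : G.EssentialVertex q) :
    ∃ last : Fin (G.shareSet p).card, ∀ l, l ≤ last :=
  have : Nonempty (Fin (G.shareSet p).card) := ⟨(exists_share_eq p hq).choose⟩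
  Finite.exists_max id

end SortedProfits

/-! ### Runs of the mechanism -/

section StartState

variable {U V : Type*} [Fintype U] [Fintype V] {G : AssignmentGame U V} {p : U ⊕ V → ℝ}
  {C : G.Comp}

theorem status_startState_ne_active : (G.startState p).status C ≠ .active := by
  by_cases h : G.UniqueImputation C <;> simp [startState, h]

theorem unsettled_status_startState :
    ((G.startState p).status C).Unsettled ↔ ¬ G.UniqueImputation C := by
  by_cases h : G.UniqueImputation C <;> simp [startState, Status.Unsettled, h]

theorem startState_Ω_le {q : U ⊕ V} (hq : G.EssentialVertex q) : (G.startState p).Ω ≤ p q :=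
  minShare_le p (Set.mem_univ q) hq

theorem valid_startState (hp : G.IsCore p) : (G.startState p).Valid where
  core := hp
  nonneg := by
    refine Real.sInf_nonneg ?_
    rintro _ ⟨q, -, rfl⟩
    exact hp.isCover.nonneg q
  start_subset := subset_rfl
  mem_edges _ := mem_edges_of_mem_startEdges
  tight _ := hp.tight
  status_eq _ he := congrArg _ (compOf_eq he)
  ne_bin _ he he' := absurd he he'
  fundamental _ := unsettled_status_startState.1
  le_profit _ hq :=
    startState_Ω_le (essentialVertex_of_not_uniqueImputation (unsettled_status_startState.1 hq))
  exists_forest := ⟨id, fun _ h => absurd h status_startState_ne_active,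
    fun _ _ h => absurd h status_startState_ne_active⟩
  rigid _ hC := ⟨_, le_rfl, fun _ _ => startState_Ω_le, fun z hz _ q hq =>
    not_not.1 (mt unsettled_status_startState.2 hC) z p hz hp q hq⟩

end StartState

namespace State

variable {U V : Type*} {G : AssignmentGame U V} {σ τ : State G} {y : U ⊕ V → ℝ} {q : U ⊕ V}
  {t δ : ℝ}

/-- `y` is consistent with being the output of the mechanism from `σ` on: settled profits are
final, the others will not end up below `Ω`. -/
structure Approximates (σ : State G) (y : U ⊕ V → ℝ) : Prop where
  eq_profit : ∀ q, ¬ (σ.status (G.compOf q)).Unsettled → y q = σ.profit q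
  le : ∀ q, (σ.status (G.compOf q)).Unsettled → σ.Ω ≤ y q

theorem Approximates.of_advance (htδ : t ≤ δ) (h : (σ.advance δ).Approximates y) :
    (σ.advance t).Approximates y where
  eq_profit q hq := by
    have hadv (s : ℝ) : (σ.advance s).profit q = σ.profit q := advance_profit_of_settled hq
    rw [h.eq_profit q hq, hadv, hadv]
  le q hq := (add_le_add_right htδ σ.Ω).trans (h.le q hq)

theorem exists_unsettled_of_not_halted (hh : ¬ σ.Halted) :
    ∃ q, (σ.status (G.compOf q)).Unsettled := by
  by_contra! h
  refine hh fun C => ?_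
  obtain ⟨q, rfl⟩ := exists_compOf_eq C
  exact not_or.1 (h q)

variable [Fintype U] [Fintype V]

theorem Approximates.agreesUpTo (h : σ.Approximates y) {l : Fin (G.shareSet y).card}
    (hΩ : G.share y l < σ.Ω) : G.AgreesUpTo y l σ.profit := by
  intro j hj q hq
  refine (h.eq_profit q fun hun => ?_).symm
  have hle := (G.share y).monotone hj
  exact (h.le q hun).not_gt (hq ▸ hle.trans_lt hΩ)

theorem Approximates.of_step (hσ : σ.Valid) (hst : Step σ τ) (h : τ.Approximates y) :
    σ.Approximates y := by
  cases hst with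
  | event _ hev =>
    have himp := hσ.event hev
    refine ⟨fun q hq => ?_, fun q hq => ?_⟩
    · rw [h.eq_profit q (mt (himp.unsettled _) hq), himp.profit_eq]
    · by_cases hq' : (τ.status (G.compOf q)).Unsettled
      · exact himp.Ω_eq ▸ h.le q hq'
      · rw [h.eq_profit q hq', himp.profit_eq]
        exact hσ.le_profit q hq
  | raise δ hδ => simpa only [advance_zero] using Approximates.of_advance hδ.2.1.le h

open Classical in
/-- The termination measure of the steps. A raising of `Ω` leads to a state where an event is
due. -/
noncomputable def stepPotential (σ : State G) : ℕ :=
  2 * σ.potential + if σ.EventDue then 0 else 1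

namespace Valid

section

variable (hσ : σ.Valid)
include hσ

theorem stepPotential_lt (h : Step σ τ) : τ.stepPotential < σ.stepPotential := by
  cases h with
  | event _ h =>
    have hlt := (hσ.event h).potential_lt
    unfold stepPotential
    split_ifs <;> omega
  | raise δ h =>
    have hpot : (σ.advance δ).potential = σ.potential := rfl
    rw [stepPotential, stepPotential, if_pos h.2.2.1, if_neg h.not_eventDue, hpot]
    omega

theorem exists_halted : ∃ τ, σ.Reaches τ ∧ τ.Halted := by
  induction hn : σ.stepPotential using Nat.strong_induction_on generalizing σ with
  | _ n ih =>
    obtain hh | ⟨σ', hstep⟩ := hσ.halted_or_exists_step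
    · exact ⟨σ, .refl, hh⟩
    · obtain ⟨τ, hτ, hh⟩ := ih _ (hn ▸ hσ.stepPotential_lt hstep) (hσ.step hstep) rfl
      exact ⟨τ, .head hstep hτ, hh⟩

theorem not_exists_run :
    ¬ ∃ run : ℕ → State G, run 0 = σ ∧ ∀ n, Step (run n) (run (n + 1)) := by
  rintro ⟨run, rfl, hrun⟩
  have hvalid (n : ℕ) : (run n).Valid := by
    induction n with
    | zero => exact hσ
    | succ n ih => exact ih.step (hrun n)
  exact not_strictAnti_of_wellFoundedLT (fun n => (run n).stepPotential)
    (strictAnti_nat_of_succ_lt fun n => (hvalid n).stepPotential_lt (hrun n))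

theorem lex_of_halted (hh : σ.Halted) {z : U ⊕ V → ℝ} (hz : G.IsCore z) (hne : z ≠ σ.profit) :
    List.Lex (· < ·) (G.sortedProfits z) (G.sortedProfits σ.profit) := by
  have hess (q : U ⊕ V) (h : z q ≠ σ.profit q) : G.EssentialVertex q := by
    by_contra hq
    exact h (by rw [hz.eq_zero hq, hσ.core.eq_zero hq])
  have hD : {q | z q ≠ σ.profit q}.Nonempty := Function.ne_iff.1 hne
  obtain ⟨r, hr, hrmin⟩ := Set.exists_min_image _ z (Set.toFinite _) hD
  obtain ⟨t, ht, htmin⟩ := Set.exists_min_image _ σ.profit (Set.toFinite _) hD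
  suffices hlt : z r < σ.profit t from
    lex_sortedProfits (hess r hr) hr hrmin fun q hq => hlt.trans_le (htmin q hq)
  by_contra! hle
  obtain ⟨θ, -, hθ, hrigid⟩ := hσ.rigid (G.compOf t) (not_or.2 (hh _))
  refine ht (hrigid z hz (fun q => or_iff_not_imp_right.2 fun hq => ?_) t rfl)
  exact (hθ t rfl (hess t ht)).trans (hle.trans (hrmin q hq))

theorem isLeximin_of_halted (hh : σ.Halted) : G.IsLeximin σ.profit :=
  ⟨hσ.core, fun _ hz => or_iff_not_imp_left.2 fun hne =>
    hσ.lex_of_halted hh hz fun h => hne (congrArg _ h)⟩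

theorem eq_of_isLeximin (hh : σ.Halted) (hy : G.IsLeximin y) : σ.profit = y := by
  by_contra hne
  have hlex := hσ.lex_of_halted hh hy.1 (Ne.symm hne)
  obtain heq | hlex' := hy.2 _ hσ.core
  · exact irrefl _ (heq ▸ hlex)
  · exact asymm hlex hlex'

theorem approximates (hy : G.IsLeximin y) : σ.Approximates y := by
  obtain ⟨τ, hτ, hh⟩ := hσ.exists_halted
  obtain rfl := (hσ.reaches hτ).eq_of_isLeximin hh hy
  clear hy
  induction hτ using Relation.ReflTransGen.head_induction_on with
  | refl => exact ⟨fun _ _ => rfl, fun _ hq => absurd hq (not_or.2 (hh _))⟩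
  | head hstep _ ih => exact .of_step hσ hstep (ih (hσ.step hstep))

end

variable {M : ℝ} (hy : G.IsLeximin y) (hM : ∀ q, G.EssentialVertex q → y q ≤ M)
include hy hM

theorem Ω_le_of_not_halted (hσ : σ.Valid) (hh : ¬ σ.Halted) : σ.Ω ≤ M := by
  obtain ⟨q, hq⟩ := exists_unsettled_of_not_halted hh
  exact ((hσ.approximates hy).le q hq).trans (hM q (hσ.essentialVertex hq))

theorem Ω_advance_le (hσ : σ.Valid) (h : σ.NextEventAfter δ) (ht : 0 ≤ t) (htδ : t ≤ δ) :
    (σ.advance t).Ω ≤ M :=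
  (hσ.advance_of_nextEventAfter h ht htδ).Ω_le_of_not_halted hy hM h.1

theorem Ω_le_of_reaches (hσ : σ.Valid) (h0 : σ.Ω ≤ M) (h : σ.Reaches τ) : τ.Ω ≤ M := by
  induction h with
  | refl => exact h0
  | tail hρ hstep ih =>
    have hv := hσ.reaches hρ
    cases hstep with
    | event _ hev => exact (hv.event hev).Ω_eq.trans_le ih
    | raise δ hδ => exact hv.Ω_advance_le hy hM hδ hδ.2.1.le le_rfl

end Valid

theorem Occurs.valid (hσ : σ.Valid) (h : σ.Occurs τ) : τ.Valid := by
  obtain ⟨ρ, hρ, rfl | ⟨δ, hδ, t, ht, htδ, rfl⟩⟩ := h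
  · exact hσ.reaches hρ
  · exact (hσ.reaches hρ).advance_of_nextEventAfter hδ ht htδ

theorem Occurs.Ω_le {M : ℝ} (hy : G.IsLeximin y) (hM : ∀ q, G.EssentialVertex q → y q ≤ M)
    (hσ : σ.Valid) (h0 : σ.Ω ≤ M) (h : σ.Occurs τ) : τ.Ω ≤ M := by
  obtain ⟨ρ, hρ, rfl | ⟨δ, hδ, t, ht, htδ, rfl⟩⟩ := h
  · exact hσ.Ω_le_of_reaches hy hM h0 hρ
  · exact (hσ.reaches hρ).Ω_advance_le hy hM hδ ht htδ

end State

variable {U V : Type*} [Fintype U] [Fintype V] {G : AssignmentGame U V} {p y : U ⊕ V → ℝ}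
  {q : U ⊕ V}

theorem existsUnique_isLeximin (G : AssignmentGame U V) : ∃! y, G.IsLeximin y := by
  obtain ⟨p, hp⟩ := G.exists_isCore
  obtain ⟨τ, hτ, hh⟩ := (valid_startState hp).exists_halted
  have hv := (valid_startState hp).reaches hτ
  exact ⟨τ.profit, hv.isLeximin_of_halted hh, fun z hz => (hv.eq_of_isLeximin hh hz).symm⟩

theorem startState_Ω_le_of_isLeximin (hp : G.IsCore p) (hy : G.IsLeximin y)
    (hq : G.EssentialVertex q) : (G.startState p).Ω ≤ y q := by
  have happrox := (valid_startState hp).approximates hy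
  by_cases hun : ((G.startState p).status (G.compOf q)).Unsettled
  · exact happrox.le q hun
  · exact (startState_Ω_le hq).trans_eq (happrox.eq_profit q hun).symm

end AssignmentGame

theorem mainTheorem1 {U V : Type*} [Fintype U] [Fintype V] (G : AssignmentGame U V)
    (hE : G.edges.Nonempty) :
    -- there is exactly one leximin core imputation `y`
    ∃ y : U ⊕ V → ℝ, G.IsLeximin y ∧ (∀ z, G.IsLeximin z → z = y) ∧
      -- `last` is the index of the largest profit share that `y` gives to an essential vertex
      ∃ last : Fin (G.shareSet y).card, (∀ l, l ≤ last) ∧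
        -- for every starting core imputation and every order of executing simultaneous events:
        ∀ p : U ⊕ V → ℝ, G.IsCore p →
          -- progress: the current imputation is in the core at all times, and it is processed up
          -- to level `l` when `Ω` is the `l`-th share plus `ε`
          (∀ σ, (G.startState p).Occurs σ → G.IsCore σ.profit ∧
            ∀ (l : Fin (G.shareSet y).card) (ε : ℝ), 0 < ε → σ.Ω = G.share y l + ε →
              G.AgreesUpTo y l σ.profit) ∧
          -- termination: there is no infinite run,
          (¬ ∃ run : ℕ → AssignmentGame.State G, run 0 = G.startState p ∧
            ∀ n, AssignmentGame.State.Step (run n) (run (n + 1))) ∧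
          -- a run can stop only by halting,
          (∀ σ, (G.startState p).Reaches σ → σ.Halted ∨ ∃ σ', AssignmentGame.State.Step σ σ') ∧
          -- it halts by time `share last + ε` for every `ε > 0`, and then it outputs `y`
          (∀ σ, (G.startState p).Occurs σ → ∀ ε : ℝ, 0 < ε → σ.Ω ≤ G.share y last + ε) ∧
          (∀ σ, (G.startState p).Reaches σ → σ.Halted → σ.profit = y) := by
  obtain ⟨y, hy, hunique⟩ := G.existsUnique_isLeximin
  obtain ⟨q₀, hq₀⟩ := AssignmentGame.exists_essentialVertex hE
  obtain ⟨last, hlast⟩ := AssignmentGame.exists_last_share y hq₀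
  have hle (q) (hq : G.EssentialVertex q) : y q ≤ G.share y last := by
    obtain ⟨l, hl⟩ := AssignmentGame.exists_share_eq y hq
    exact hl ▸ (G.share y).monotone (hlast l)
  refine ⟨y, hy, hunique, last, hlast, fun p hp => ?_⟩
  have hstart := AssignmentGame.valid_startState hp
  have hΩ : (G.startState p).Ω ≤ G.share y last :=
    (AssignmentGame.startState_Ω_le_of_isLeximin hp hy hq₀).trans (hle q₀ hq₀)
  refine ⟨fun σ hσ => ⟨(hσ.valid hstart).core, fun l ε hε hl => ?_⟩, hstart.not_exists_run,
    fun σ hσ => (hstart.reaches hσ).halted_or_exists_step, fun σ hσ ε hε => ?_,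
    fun σ hσ hh => (hstart.reaches hσ).eq_of_isLeximin hh hy⟩
  · exact ((hσ.valid hstart).approximates hy).agreesUpTo (by linarith)
  · linarith [hσ.Ω_le hy hle hstart hΩ]
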